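/- **Setting.** Fix $q\ge 0$ and a delay $D>0$. For matrices $A_1,\dots,A_p\in\mathbb R^{q\times q}$, columns $B_i\in\mathbb R^{q}$ and rows $K_i\in\mathbb R^{1\times q}$, consider the switched system with delayed scalar input $$\dot X(t)=A_{\sigma(t)}X(t)+B_{\sigma(t)}U(t-D),\qquad t\ge 0,$$ with $X(0)=X_0\in\mathbb R^q$ and $U=U_0$ on $[-D,0]$, $U_0\in L^2([-D,0];\mathbb R)$. There are switching times $0=t_0<t_1<t_2<\cdots$ with $\tau_d\le t_{k+1}-t_k\le\bar\tau_d$ for all $k$, and $\sigma:[0,\infty)\to\{1,\dots,p\}$ is constant on each $[t_k,t_{k+1})$. The norm $|\cdot|$ is the Euclidean norm and the matrix norm it induces. For designer-chosen $\bar A,\bar B,\bar K$, the average-predictor feedback is $U(t)=U_1(t)$, $t\ge0$, where $$U_1(t)=\bar K\Big(e^{\bar A(D-\tau(t))}\,\widehat X(t)+\int_{t+\tau(t)-D}^{t}e^{\bar A(t-\theta)}\bar B\,U(\theta)\,d\theta\Big),$$ $$\widehat X(t)=e^{A_j\tau(t)}X(t)+\int_{t-D}^{t+\tau(t)-D}e^{A_j(t+\tau(t)-D-\theta)}B_j\,U(\theta)\,d\theta,\qquad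 j=\sigma(\tau_0(t)),$$ $\tau_0(t)=\max\{t_k: t_k\le t\}$ and $\tau(t)=\max\{0,\min\{\tau_0(t)+\tau_d-t,\;D\}\}$ (which is $\max\{0,\tau_0(t)+\tau_d-t\}$ when $\tau_d\le D$). A solution of the closed loop is a pair $(X,U)$ with $X$ continuous on $[0,\infty)$, $U\in L^2$ on every $[-D,T]$, $U=U_0$ a.e. on $[-D,0]$, the differential equation satisfied in integrated (Carathéodory) form, and $U(t)=U_1(t)$ for all $t\ge 0$. Put $$\epsilon=\max_{i=1,\dots,p}\{|A_i-\bar A|,\,|B_i-\bar B|,\,|K_i-\bar K|\}.$$ **Theorem.** Let $\mathcal C\subset\mathbb R^{q\times q}\times\mathbb R^{q}\times\mathbb R^{1\times q}$ be a compact set of triples $(A,B,K)$ such that $A+BK$ is Hurwitz. Then each such triple has symmetric positive definite matrices $S,Q$ with $(A+BK)^TS+S(A+BK)=-Q$. Moreover, there exist $\tau_d^\star>0$ and $\epsilon^\star>0$, depending only on $D$ and $\mathcal C$, such that the following holds for every finite family of modes with $(A_i,B_i,K_i)\in\mathcal C$, $i=1,\dots,p$, and every $\bar A,\bar B,\bar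 K$ with $\epsilon<\epsilon^\star$. For all $\tau_d>\tau_d^\star$ and all $\bar\tau_d$ there exist constants $\rho,\xi>0$ such that, for every switching signal $\sigma$ as above, every $X_0\in\mathbb R^q$ and every $U_0\in L^2([-D,0];\mathbb R)$, the closed loop has a solution on $[0,\infty)$, and every solution satisfies $$|X(t)|+\sqrt{\int_{t-D}^{t}U(\theta)^2d\theta}\;\le\;\rho\Big(|X_0|+\sqrt{\int_{-D}^{0}U_0(\theta)^2d\theta}\Big)e^{-\xi t},\qquad t\ge 0.$$ -/

import Mathlib

open MeasureTheory Set

/-- The state space `ℝ^q` with the Euclidean norm. -/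
abbrev State (q : ℕ) : Type := EuclideanSpace ℝ (Fin q)

/-- The linear operator on `ℝ^q` given by a square matrix. Its operator norm is the matrix norm
induced by the Euclidean norm. -/
noncomputable def matOp {q : ℕ} (A : Matrix (Fin q) (Fin q) ℝ) : State q →L[ℝ] State q :=
  Matrix.toEuclideanCLM (n := Fin q) (𝕜 := ℝ) A

/-- The action `x ↦ e^{A s} x` of the matrix exponential. -/
noncomputable def expOp {q : ℕ} (A : Matrix (Fin q) (Fin q) ℝ) (s : ℝ) :
    State q →L[ℝ] State q :=
  NormedSpace.exp (s • matOp A)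

/-- The delay-free closed-loop matrix `A + B K`, for a column `B` and a row `K`; the row `K` is
given by the vector of its entries, so that `K x = ⟪K, x⟫`. -/
def closedLoopMatrix {q : ℕ} (A : Matrix (Fin q) (Fin q) ℝ) (B K : State q) :
    Matrix (Fin q) (Fin q) ℝ :=
  A + Matrix.vecMulVec B.ofLp K.ofLp

/-- A real matrix is Hurwitz if all its complex eigenvalues have negative real part. -/
def IsHurwitz {q : ℕ} (M : Matrix (Fin q) (Fin q) ℝ) : Prop :=
  ∀ z ∈ spectrum ℂ (M.map Complex.ofReal), z.re < 0

/-- `(S, Q)` is a Lyapunov pair for `M`. -/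
def IsLyapunovPair {q : ℕ} (M S Q : Matrix (Fin q) (Fin q) ℝ) : Prop :=
  S.PosDef ∧ Q.PosDef ∧ M.transpose * S + S * M = -Q

/-- `ε = max_i {|A_i - Ā|, |B_i - B̄|, |K_i - K̄|}`. -/
noncomputable def mismatch {q p : ℕ} (A : Fin p → Matrix (Fin q) (Fin q) ℝ)
    (B K : Fin p → State q) (Abar : Matrix (Fin q) (Fin q) ℝ) (Bbar Kbar : State q) : ℝ :=
  ⨆ i : Fin p, max ‖matOp (A i - Abar)‖ (max ‖B i - Bbar‖ ‖K i - Kbar‖)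

/-- `σ` is a right-continuous piecewise constant signal with switching times
`0 = t_0 < t_1 < ⋯` whose consecutive distances lie in `[τmin, τmax]`. -/
structure IsSwitchingSignal {p : ℕ} (τmin τmax : ℝ) (t : ℕ → ℝ) (σ : ℝ → Fin p) : Prop where
  zero : t 0 = 0
  min_dwell : ∀ k, τmin ≤ t (k + 1) - t k
  max_dwell : ∀ k, t (k + 1) - t k ≤ τmax
  const : ∀ k, ∀ s ∈ Ico (t k) (t (k + 1)), σ s = σ (t k)

/-- `τ_0(s)`: the last switching time not after `s`. -/
noncomputable def lastSwitch (t : ℕ → ℝ) (s : ℝ) : ℝ :=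
  sSup (range t ∩ Iic s)

/-- `τ(s) = max {0, min {τ_0(s) + τ_d - s, D}}`: how far ahead of `s` (and at most `D`) the mode
is known. For `τ_d ≤ D` and `s ≥ 0` this is `max {0, τ_0(s) + τ_d - s}`. -/
noncomputable def horizon (D τd : ℝ) (t : ℕ → ℝ) (s : ℝ) : ℝ :=
  max 0 (min (lastSwitch t s + τd - s) D)

/-- The exact prediction, at time `s`, of the state at time `s + h`, for a mode `(A, B)` that is
active on `[s, s + h]`:
`e^{A h} X(s) + ∫_{s-D}^{s+h-D} e^{A (s+h-D-θ)} B U(θ) dθ`. -/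
noncomputable def modePrediction {q : ℕ} (D : ℝ) (A : Matrix (Fin q) (Fin q) ℝ) (B : State q)
    (X : ℝ → State q) (U : ℝ → ℝ) (s h : ℝ) : State q :=
  expOp A h (X s) + ∫ θ in (s - D)..(s + h - D), U θ • expOp A (s + h - D - θ) B

/-- The average-predictor feedback `U_1(s)`. -/
noncomputable def averagePredictorFeedback {q p : ℕ} (D τd : ℝ)
    (A : Fin p → Matrix (Fin q) (Fin q) ℝ) (B : Fin p → State q)
    (Abar : Matrix (Fin q) (Fin q) ℝ) (Bbar Kbar : State q)
    (t : ℕ → ℝ) (σ : ℝ → Fin p) (X : ℝ → State q) (U : ℝ → ℝ) (s : ℝ) : ℝ :=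
  inner ℝ Kbar
    (expOp Abar (D - horizon D τd t s)
        (modePrediction D (A (σ (lastSwitch t s))) (B (σ (lastSwitch t s))) X U s
          (horizon D τd t s))
      + ∫ θ in (s + horizon D τd t s - D)..s, U θ • expOp Abar (s - θ) Bbar)

/-- `(X, U)` is a (Carathéodory) solution on `[0, ∞)` of the closed loop
`X'(s) = A_{σ(s)} X(s) + B_{σ(s)} U(s - D)`, `U(s) = U_1(s)`, with initial data `X(0) = X0` and
`U = U0` on `[-D, 0]`. The differential equation is written in its integrated form; the integrand
is locally integrable by the first two fields. -/
structure IsClosedLoopSolution {q p : ℕ} (D τd : ℝ)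
    (A : Fin p → Matrix (Fin q) (Fin q) ℝ) (B : Fin p → State q)
    (Abar : Matrix (Fin q) (Fin q) ℝ) (Bbar Kbar : State q)
    (t : ℕ → ℝ) (σ : ℝ → Fin p) (X0 : State q) (U0 : ℝ → ℝ)
    (X : ℝ → State q) (U : ℝ → ℝ) : Prop where
  continuousOn : ContinuousOn X (Ici 0)
  memLp : ∀ T : ℝ, MemLp U 2 (volume.restrict (Icc (-D) T))
  initial : ∀ᵐ θ ∂(volume.restrict (Icc (-D) 0)), U θ = U0 θ
  plant : ∀ s : ℝ, 0 ≤ s →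
    X s = X0 + ∫ r in (0 : ℝ)..s, (matOp (A (σ r)) (X r) + U (r - D) • B (σ r))
  control : ∀ s : ℝ, 0 ≤ s →
    U s = averagePredictorFeedback D τd A B Abar Bbar Kbar t σ X U s

/-! Between two switches the mode `(A, B, K)` is fixed. Let `P(s) = e^{AD} X(s) + ∫_{s-D}^s
e^{A(s-θ)} B U(θ) dθ` be the prediction of `X(s + D)` that freezes this mode. Variation of constants
removes the delay: `P' = A P + B U`, that is, `P' = (A + B K) P + B (U - K P)`. The averaged
feedback is a small perturbation of `K P`: with `N(s) = |X(s)| + ‖U‖_{L²[s-D,s]}`, one has `|U(s) -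
K P(s)| ≤ c ε N(s)`, where `c` does not depend on how much of the horizon is predicted with the true
mode (`exists_abs_feedback_sub_le`).

The semigroup `e^{(A+BK)s}` decays, and `N` is controlled by `P` and the recent input. Hence the
maximum `m` of `e^{ν(s-a)} N(s)` over a mode interval starting at `a` satisfies `m ≤ C₁ N(a) + C₂ ε
m`. A small `ε` absorbs the last term, so `N` decays within the mode up to an overshoot factor `c`
(`exists_delayNorm_le_of_isModeSolution`). `P` changes its definition at a switch, but `N` does not
involve the mode, so these estimates chain; a dwell time of at least `log c / ν` pays for the
overshoot (`IsSwitchingSignal.le_exp_of_forall_mode`).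

Uniformity over the compact set needs only a bound on the data and a common estimate `‖e^{(A+BK)s}‖
≤ M e^{-μs}`. For one Hurwitz matrix decay follows from spectral mapping and Gelfand's formula;
`‖e^{NL}‖ < 1/2` is an open condition on `L`, and compactness does the rest
(`IsCompact.exists_uniform_exponential_decay`). No Lyapunov functional enters the stability
argument; the pairs `(S, Q)` come separately from the invertibility of `S ↦ Mᵀ S + S M`.

For existence, within one mode the state is an explicit function of the input, so the feedback law
is a Volterra fixed-point equation for `U` alone (`exists_isModeSolution`). The pieces are glued
over the switching intervals. -/

/-! ### Integration by parts for operator-valued functions -/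

section PartialIntegration

variable {E : Type*} [NormedAddCommGroup E] [NormedSpace ℝ E]

theorem IntervalIntegrable.clm_apply {Ψ : ℝ → E →L[ℝ] E} (hΨ : Continuous Ψ)
    {g : ℝ → E} {a s : ℝ} (hg : IntervalIntegrable g volume a s) :
    IntervalIntegrable (fun r => Ψ r (g r)) volume a s := by
  rw [intervalIntegrable_iff] at hg ⊢
  obtain ⟨c, hc⟩ := isCompact_uIcc.exists_bound_of_continuousOn (hΨ.continuousOn (s := uIcc a s))
  refine (hg.norm.const_mul c).mono' ((ContinuousLinearMap.apply ℝ E).flip.aestronglyMeasurable_comp₂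
    hΨ.aestronglyMeasurable hg.aestronglyMeasurable) ?_
  refine (ae_restrict_iff' measurableSet_uIoc).2 (.of_forall fun z hz => ?_)
  exact ((Ψ z).le_opNorm _).trans
    (mul_le_mul_of_nonneg_right (hc _ (uIoc_subset_uIcc hz)) (norm_nonneg _))

variable [CompleteSpace E]

/-- Integration by parts of a differentiable operator-valued function against the primitive of an
integrable function. -/
theorem integral_clm_apply_primitive {Φ Φ' : ℝ → E →L[ℝ] E}
    (hΦ : ∀ r, HasDerivAt Φ (Φ' r) r) (hΦ' : Continuous Φ') {g : ℝ → E} {a s : ℝ} (has : a ≤ s)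
    (hg : IntervalIntegrable g volume a s) :
    ∫ r in a..s, Φ' r (∫ θ in a..r, g θ) = ∫ r in a..s, (Φ s - Φ r) (g r) := by
  have hg' : IntegrableOn g (Ioc a s) := (intervalIntegrable_iff_integrableOn_Ioc_of_le has).1 hg
  -- The proof is Fubini on the triangle `a < θ ≤ r ≤ s`, encoded by an indicator so that both
  -- integrals run over the fixed interval `(a, s]`.
  have hint : Integrable (Function.uncurry fun r θ : ℝ => (Iic r).indicator (fun θ => Φ' r (g θ)) θ)
      ((volume.restrict (Ioc a s)).prod (volume.restrict (Ioc a s))) := by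
    obtain ⟨c, hc⟩ := isCompact_Icc.exists_bound_of_continuousOn (hΦ'.continuousOn (s := Icc a s))
    have h1 : AEStronglyMeasurable (fun z : ℝ × ℝ => Φ' z.1 (g z.2))
        ((volume.restrict (Ioc a s)).prod (volume.restrict (Ioc a s))) := by
      have hp : AEStronglyMeasurable (fun z : ℝ × ℝ => Φ' z.1)
          ((volume.restrict (Ioc a s)).prod (volume.restrict (Ioc a s))) :=
        (hΦ'.comp continuous_fst).aestronglyMeasurable
      have hq : AEStronglyMeasurable (fun z : ℝ × ℝ => g z.2)
          ((volume.restrict (Ioc a s)).prod (volume.restrict (Ioc a s))) :=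
        hg'.aestronglyMeasurable.comp_snd
      exact (ContinuousLinearMap.apply ℝ E).flip.aestronglyMeasurable_comp₂ hp hq
    have h2 : (Function.uncurry fun r θ : ℝ => (Iic r).indicator (fun θ => Φ' r (g θ)) θ) =
        {z : ℝ × ℝ | z.2 ≤ z.1}.indicator (fun z => Φ' z.1 (g z.2)) := by
      ext ⟨r, θ⟩; simp [indicator, Function.uncurry]
    have hm : MeasurableSet {z : ℝ × ℝ | z.2 ≤ z.1} := measurableSet_le measurable_snd measurable_fst
    rw [h2]
    have hdom : Integrable (fun z : ℝ × ℝ => c * ‖g z.2‖)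
        ((volume.restrict (Ioc a s)).prod (volume.restrict (Ioc a s))) :=
      (hg'.norm.comp_snd _).const_mul c
    refine Integrable.indicator (hdom.mono' h1 ?_) hm
    rw [Measure.prod_restrict]
    refine (ae_restrict_iff' (measurableSet_Ioc.prod measurableSet_Ioc)).2 (.of_forall ?_)
    intro z hz
    exact ((Φ' z.1).le_opNorm _).trans
      (mul_le_mul_of_nonneg_right (hc _ (Ioc_subset_Icc_self hz.1)) (norm_nonneg _))
  rw [intervalIntegral.integral_of_le has, intervalIntegral.integral_of_le has]
  have e1 : ∫ r in Ioc a s, Φ' r (∫ θ in a..r, g θ) =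
      ∫ r in Ioc a s, ∫ θ in Ioc a s, (Iic r).indicator (fun θ => Φ' r (g θ)) θ := by
    refine setIntegral_congr_fun measurableSet_Ioc fun r hr => ?_
    rw [setIntegral_indicator measurableSet_Iic, Ioc_inter_Iic, min_eq_right hr.2,
      intervalIntegral.integral_of_le hr.1.le, ContinuousLinearMap.integral_comp_comm]
    exact hg'.mono_set (Ioc_subset_Ioc_right hr.2)
  rw [e1, integral_integral_swap hint]
  refine setIntegral_congr_fun measurableSet_Ioc fun θ hθ => ?_
  have e2 : ∫ r in Ioc a s, (Iic r).indicator (fun θ => Φ' r (g θ)) θ =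
      ∫ r in Ioc a s, (Ici θ).indicator (fun r => Φ' r (g θ)) r := by
    refine setIntegral_congr_fun measurableSet_Ioc fun r _ => ?_
    simp [indicator]
  have e3 : Ioc a s ∩ Ici θ = Icc θ s := by
    ext r; simp only [mem_inter_iff, mem_Ioc, mem_Ici, mem_Icc]
    exact ⟨fun h => ⟨h.2, h.1.2⟩, fun h => ⟨⟨hθ.1.trans_le h.1, h.2⟩, h.1⟩⟩
  rw [e2, setIntegral_indicator measurableSet_Ici, e3, integral_Icc_eq_integral_Ioc,
    ← intervalIntegral.integral_of_le hθ.2,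
    intervalIntegral.integral_eq_sub_of_hasDerivAt (f := fun r => Φ r (g θ))]
  · simp
  · intro r _
    simpa using (hΦ r).clm_apply (hasDerivAt_const r (g θ))
  · exact (hΦ'.clm_apply continuous_const).intervalIntegrable _ _

/-- Product rule in integrated form. -/
theorem clm_apply_eq_add_integral {Φ Φ' : ℝ → E →L[ℝ] E}
    (hΦ : ∀ r, HasDerivAt Φ (Φ' r) r) (hΦ' : Continuous Φ') {g v : ℝ → E} {a s : ℝ} (has : a ≤ s)
    (hg : IntervalIntegrable g volume a s)
    (hv : ∀ r ∈ Icc a s, v r = v a + ∫ θ in a..r, g θ) :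
    Φ s (v s) = Φ a (v a) + ∫ r in a..s, (Φ' r (v r) + Φ r (g r)) := by
  have hc : Continuous Φ := continuous_iff_continuousAt.2 fun r => (hΦ r).continuousAt
  have hprim : ContinuousOn (fun r => ∫ θ in a..r, g θ) (uIcc a s) :=
    intervalIntegral.continuousOn_primitive_interval' hg left_mem_uIcc
  have i1 : IntervalIntegrable (fun r => Φ' r (v a)) volume a s :=
    (hΦ'.clm_apply continuous_const).intervalIntegrable _ _
  have i2 : IntervalIntegrable (fun r => Φ' r (∫ θ in a..r, g θ)) volume a s :=
    (hΦ'.continuousOn.clm_apply hprim).intervalIntegrable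
  have e1 : ∫ r in a..s, (Φ' r (v r) + Φ r (g r)) =
      ∫ r in a..s, (Φ' r (v a) + Φ' r (∫ θ in a..r, g θ) + Φ r (g r)) := by
    refine intervalIntegral.integral_congr fun r hr => ?_
    rw [uIcc_of_le has] at hr
    rw [hv r hr, map_add]
  have e2 : ∫ r in a..s, Φ' r (v a) = Φ s (v a) - Φ a (v a) :=
    intervalIntegral.integral_eq_sub_of_hasDerivAt (f := fun r => Φ r (v a))
      (fun r _ => by simpa using (hΦ r).clm_apply (hasDerivAt_const r (v a))) i1
  have e3 : ∫ r in a..s, (Φ s - Φ r) (g r) =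
      Φ s (∫ r in a..s, g r) - ∫ r in a..s, Φ r (g r) := by
    rw [← ContinuousLinearMap.intervalIntegral_comp_comm _ hg,
      ← intervalIntegral.integral_sub (hg.clm_apply continuous_const) (hg.clm_apply hc)]
    rfl
  rw [e1, intervalIntegral.integral_add (i1.add i2) (hg.clm_apply hc), intervalIntegral.integral_add i1 i2,
    e2, integral_clm_apply_primitive hΦ hΦ' has hg, e3, hv s (right_mem_Icc.2 has), map_add]
  abel

end PartialIntegration

/-! ### One-parameter groups and variation of constants -/

section Flow

variable {E : Type*} [NormedAddCommGroup E] [NormedSpace ℝ E]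

/-- The one-parameter group `s ↦ e^{s L}`. -/
noncomputable def flow (L : E →L[ℝ] E) (s : ℝ) : E →L[ℝ] E := NormedSpace.exp (s • L)

theorem flow_zero (L : E →L[ℝ] E) : flow L 0 = 1 := by
  simp [flow, NormedSpace.exp_zero]

theorem norm_exp_clm_le (L : E →L[ℝ] E) : ‖NormedSpace.exp L‖ ≤ Real.exp ‖L‖ := by
  let : NormedAlgebra ℚ (E →L[ℝ] E) := NormedAlgebra.restrictScalars ℚ ℝ _
  rw [NormedSpace.exp_eq_tsum ℝ, Real.exp_eq_exp_ℝ, NormedSpace.exp_eq_tsum ℝ]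
  have hs : Summable fun n : ℕ => ((n.factorial : ℝ)⁻¹) • ‖L‖ ^ n :=
    NormedSpace.expSeries_summable' (𝕂 := ℝ) ‖L‖
  refine tsum_of_norm_bounded hs.hasSum fun n => ?_
  rw [norm_smul, norm_inv, Real.norm_natCast, smul_eq_mul]
  refine mul_le_mul_of_nonneg_left ?_ (by positivity)
  -- The term `n = 0` is separate because the identity has norm `0` on the trivial space, so only
  -- `‖1‖ ≤ 1` is available.
  rcases n with _ | n
  · rw [pow_zero, pow_zero]; exact ContinuousLinearMap.norm_id_le
  · exact norm_pow_le' L n.succ_pos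

theorem norm_flow_le {L : E →L[ℝ] E} {R s T : ℝ} (hL : ‖L‖ ≤ R) (hs : |s| ≤ T) :
    ‖flow L s‖ ≤ Real.exp (T * R) := by
  refine (norm_exp_clm_le _).trans (Real.exp_le_exp.2 ?_)
  rw [norm_smul, Real.norm_eq_abs]
  exact mul_le_mul hs hL (norm_nonneg _) ((abs_nonneg s).trans hs)

variable [CompleteSpace E]

theorem flow_add (L : E →L[ℝ] E) (s t : ℝ) : flow L (s + t) = flow L s * flow L t := by
  let : NormedAlgebra ℚ (E →L[ℝ] E) := NormedAlgebra.restrictScalars ℚ ℝ _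
  rw [flow, add_smul]
  exact NormedSpace.exp_add_of_commute (((Commute.refl L).smul_left s).smul_right t)

theorem flow_flow_apply (L : E →L[ℝ] E) (s t : ℝ) (x : E) :
    flow L s (flow L t x) = flow L (s + t) x := by
  rw [flow_add]; rfl

theorem hasDerivAt_flow (L : E →L[ℝ] E) (s : ℝ) : HasDerivAt (flow L) (flow L s * L) s :=
  hasDerivAt_exp_smul_const L s

theorem hasDerivAt_flow' (L : E →L[ℝ] E) (s : ℝ) : HasDerivAt (flow L) (L * flow L s) s :=
  hasDerivAt_exp_smul_const' L s

theorem continuous_flow (L : E →L[ℝ] E) : Continuous (flow L) :=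
  continuous_iff_continuousAt.2 fun s => (hasDerivAt_flow L s).continuousAt

/-- Duhamel interpolation: `r ↦ e^{(s-r)L'} e^{rL}` runs from `e^{sL'}` to `e^{sL}` with derivative
`e^{(s-r)L'} (L - L') e^{rL}`. -/
theorem norm_flow_sub_flow_le {L L' : E →L[ℝ] E} {R s : ℝ} (hL : ‖L‖ ≤ R) (hL' : ‖L'‖ ≤ R)
    (hs : 0 ≤ s) :
    ‖flow L s - flow L' s‖ ≤ s * Real.exp (s * R) ^ 2 * ‖L - L'‖ := by
  have hd : ∀ r ∈ Icc 0 s, HasDerivWithinAt (fun r => flow L' (s - r) * flow L r)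
      (flow L' (s - r) * (L - L') * flow L r) (Icc 0 s) r := by
    intro r _
    have h1 : HasDerivAt (fun r => flow L' (s - r)) (-(flow L' (s - r) * L')) r :=
      (hasDerivAt_flow L' (s - r)).comp_const_sub s r
    have h2 := h1.mul (hasDerivAt_flow' L r)
    refine (h2.congr_deriv ?_).hasDerivWithinAt
    noncomm_ring
  have hb : ∀ r ∈ Ico 0 s, ‖flow L' (s - r) * (L - L') * flow L r‖ ≤
      Real.exp (s * R) ^ 2 * ‖L - L'‖ := by
    intro r hr
    have h1 : ‖flow L' (s - r)‖ ≤ Real.exp (s * R) :=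
      norm_flow_le hL' (by rw [abs_of_nonneg] <;> linarith [hr.1, hr.2])
    have h2 : ‖flow L r‖ ≤ Real.exp (s * R) :=
      norm_flow_le hL (by rw [abs_of_nonneg] <;> linarith [hr.1, hr.2])
    calc _ ≤ ‖flow L' (s - r)‖ * ‖L - L'‖ * ‖flow L r‖ :=
          (norm_mul_le _ _).trans (mul_le_mul_of_nonneg_right (norm_mul_le _ _) (norm_nonneg _))
      _ ≤ Real.exp (s * R) * ‖L - L'‖ * Real.exp (s * R) := by gcongr
      _ = _ := by ring
  have := norm_image_sub_le_of_norm_deriv_le_segment' hd hb s (right_mem_Icc.2 hs)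
  simp only [sub_self, flow_zero, one_mul, sub_zero, mul_one] at this
  linarith

/-- Variation of constants: a solution of the integral equation of `X' = L X + f` is given by the
variation-of-constants formula. -/
theorem eq_flow_add_integral_of_integral_eq {L : E →L[ℝ] E} {X f : ℝ → E} {a s : ℝ} (has : a ≤ s)
    (hX : ContinuousOn X (Icc a s)) (hf : IntervalIntegrable f volume a s)
    (h : ∀ r ∈ Icc a s, X r = X a + ∫ θ in a..r, (L (X θ) + f θ)) :
    X s = flow L (s - a) (X a) + ∫ r in a..s, flow L (s - r) (f r) := by
  -- Differentiating `r ↦ e^{(s-r)L} X(r)` cancels the terms in `L X` and leaves `e^{(s-r)L} f(r)`.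
  have hd : ∀ r, HasDerivAt (fun r => flow L (s - r)) (-(flow L (s - r) * L)) r := fun r =>
    (hasDerivAt_flow L (s - r)).comp_const_sub s r
  have hc : Continuous fun r => -(flow L (s - r) * L) :=
    (((continuous_flow L).comp (continuous_const.sub continuous_id)).mul continuous_const).neg
  have hX' : ContinuousOn X (uIcc a s) := by rwa [uIcc_of_le has]
  have hg : IntervalIntegrable (fun θ => L (X θ) + f θ) volume a s :=
    (L.continuous.comp_continuousOn hX').intervalIntegrable.add hf
  have := clm_apply_eq_add_integral hd hc has hg h
  simp only [sub_self, flow_zero, one_apply_eq_self] at this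
  rw [this]
  congr 1
  refine intervalIntegral.integral_congr fun r _ => ?_
  simp

/-- Converse of the variation-of-constants formula. -/
theorem integral_eq_of_eq_flow_add_integral {L : E →L[ℝ] E} {X f : ℝ → E} {x : E} {a b : ℝ}
    (hf : IntervalIntegrable f volume a b)
    (h : ∀ s ∈ Icc a b, X s = flow L (s - a) x + ∫ r in a..s, flow L (s - r) (f r)) :
    ∀ s ∈ Icc a b, X s = x + ∫ r in a..s, (L (X r) + f r) := by
  intro s hs
  have hd : ∀ r, HasDerivAt (fun r => flow L (r - a)) (L * flow L (r - a)) r := fun r =>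
    (hasDerivAt_flow' L (r - a)).comp_sub_const r a
  have hcf := continuous_flow L
  have hc : Continuous fun r => L * flow L (r - a) := by fun_prop
  have hsub : ∀ {r}, r ∈ Icc a b → uIcc a r ⊆ uIcc a b := fun {r} hr => by
    rw [uIcc_of_le hr.1, uIcc_of_le (hr.1.trans hr.2)]; exact Icc_subset_Icc_right hr.2
  have hg : IntervalIntegrable (fun r => flow L (a - r) (f r)) volume a b :=
    hf.clm_apply (by fun_prop)
  -- In the moving frame, `v(s) = e^{(a-s)L} X(s)` is a plain primitive, to which the product rule
  -- applies.
  set v : ℝ → E := fun s => x + ∫ r in a..s, flow L (a - r) (f r) with hv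
  have hXv : ∀ r ∈ Icc a b, X r = flow L (r - a) (v r) := by
    intro r hr
    rw [h r hr, hv, map_add, ← ContinuousLinearMap.intervalIntegral_comp_comm _
      (hg.mono_set (hsub hr))]
    simp only [flow_flow_apply, sub_add_sub_cancel]
  have key := clm_apply_eq_add_integral (v := v) hd hc hs.1 (hg.mono_set (hsub hs))
    (by intro r _; simp [hv])
  rw [hXv s hs, key]
  have hva : v a = x := by simp [hv]
  rw [hva, sub_self, flow_zero]
  congr 1
  refine intervalIntegral.integral_congr fun r hr => ?_
  rw [uIcc_of_le hs.1] at hr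
  simp [hXv r ⟨hr.1, hr.2.trans hs.2⟩, flow_flow_apply, flow_zero]

end Flow

/-! ### Decay for a single Hurwitz matrix -/

section HurwitzDecay

open Filter Topology

/-- By Gelfand's formula `‖a ^ n‖ ≤ r ^ n` eventually, for any `r` strictly between the spectral
radius and `1`. -/
theorem tendsto_pow_of_spectralRadius_lt_one {A : Type*} [NormedRing A] [NormedAlgebra ℂ A]
    [CompleteSpace A] {a : A} (ha : spectralRadius ℂ a < 1) :
    Tendsto (fun n : ℕ => a ^ n) atTop (𝓝 0) := by
  obtain ⟨r, hr, hr1⟩ := ENNReal.lt_iff_exists_nnreal_btwn.1 ha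
  have hr1' : r < 1 := by exact_mod_cast hr1
  have hev := (spectrum.pow_nnnorm_pow_one_div_tendsto_nhds_spectralRadius a).eventually_lt_const hr
  have hlim : Tendsto (fun n : ℕ => (r : ℝ) ^ n) atTop (𝓝 0) :=
    tendsto_pow_atTop_nhds_zero_of_lt_one r.2 (by exact_mod_cast hr1')
  refine squeeze_zero_norm' ?_ hlim
  filter_upwards [hev, eventually_gt_atTop 0] with n hn hn0
  have hn0' : (n : ℝ) ≠ 0 := by exact_mod_cast hn0.ne'
  have h1 : (‖a ^ n‖₊ : ENNReal) ≤ (r : ENNReal) ^ n := by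
    have := ENNReal.rpow_le_rpow hn.le (n.cast_nonneg : (0 : ℝ) ≤ n)
    rwa [← ENNReal.rpow_mul, one_div, inv_mul_cancel₀ hn0', ENNReal.rpow_one,
      ENNReal.rpow_natCast] at this
  have h2 : ‖a ^ n‖₊ ≤ r ^ n := by exact_mod_cast h1
  exact_mod_cast h2

variable {V : Type*} [NormedAddCommGroup V] [NormedSpace ℂ V]

theorem exp_apply_eq_smul [CompleteSpace V] {L : V →L[ℂ] V} {v : V} {μ : ℂ} (h : L v = μ • v) :
    NormedSpace.exp L v = Complex.exp μ • v := by
  have hpow : ∀ n : ℕ, (L ^ n) v = μ ^ n • v := by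
    intro n
    induction n with
    | zero => simp
    | succ n ih => rw [pow_succ', pow_succ', mul_apply_eq_comp, ih, map_smul, h,
        smul_smul, mul_comm]
  have h1 : HasSum (fun n : ℕ => ((n.factorial : ℂ)⁻¹ • L ^ n) v) (NormedSpace.exp L v) :=
    (NormedSpace.exp_series_hasSum_exp' (𝕂 := ℂ) L).mapL (ContinuousLinearMap.apply ℂ V v)
  have h2 : HasSum (fun n : ℕ => ((n.factorial : ℂ)⁻¹ • μ ^ n) • v) (Complex.exp μ • v) := by
    rw [Complex.exp_eq_exp_ℂ]
    exact (NormedSpace.exp_series_hasSum_exp' (𝕂 := ℂ) μ).smul_const v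
  refine h1.unique (h2.congr_fun ?_)
  intro n
  simp [hpow, smul_smul]

variable [FiniteDimensional ℂ V]

/-- The eigenspace of `e^L` for `z` is `L`-invariant, as `L` commutes with `e^L`. Over `ℂ` it
contains an eigenvector of `L`, whose eigenvalue `μ` must satisfy `e^μ = z`. -/
theorem exists_exp_eq_of_mem_spectrum_exp {L : V →L[ℂ] V} {z : ℂ}
    (hz : z ∈ spectrum ℂ (NormedSpace.exp L)) : ∃ μ ∈ spectrum ℂ L, Complex.exp μ = z := by
  have : CompleteSpace V := FiniteDimensional.complete ℂ V
  let e := Module.End.toContinuousLinearMap (𝕜 := ℂ) V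
  have hspec : ∀ T : V →L[ℂ] V, spectrum ℂ (T : V →ₗ[ℂ] V) = spectrum ℂ T := fun T =>
    AlgEquiv.spectrum_eq e.symm T
  rw [← hspec, ← Module.End.hasEigenvalue_iff_mem_spectrum] at hz
  set W := Module.End.eigenspace ((NormedSpace.exp L : V →L[ℂ] V) : V →ₗ[ℂ] V) z with hW
  have hcomm : Commute L (NormedSpace.exp L) := by
    let : NormedAlgebra ℚ (V →L[ℂ] V) := NormedAlgebra.restrictScalars ℚ ℂ _
    exact (Commute.refl L).exp_right
  have hinv : ∀ w ∈ W, (L : V →ₗ[ℂ] V) w ∈ W := by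
    intro w hw
    rw [hW, Module.End.mem_eigenspace_iff] at hw ⊢
    have h1 : L (NormedSpace.exp L w) = NormedSpace.exp L (L w) := DFunLike.congr_fun hcomm.eq w
    have hw' : NormedSpace.exp L w = z • w := hw
    change NormedSpace.exp L (L w) = z • L w
    rw [← h1, hw', map_smul]
  have : Nontrivial W := (Submodule.nontrivial_iff_ne_bot).2 hz
  obtain ⟨μ, hμ⟩ := Module.End.exists_eigenvalue ((L : V →ₗ[ℂ] V).restrict hinv)
  obtain ⟨v, hv⟩ := hμ.exists_hasEigenvector
  have hv0 : (v : V) ≠ 0 := fun h => hv.2 (Subtype.ext h)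
  have hLv : L v = μ • (v : V) := congrArg Subtype.val hv.apply_eq_smul
  refine ⟨μ, ?_, ?_⟩
  · rw [← hspec, ← Module.End.hasEigenvalue_iff_mem_spectrum]
    exact Module.End.hasEigenvalue_of_hasEigenvector
      (x := (v : V)) ⟨Module.End.mem_eigenspace_iff.2 hLv, hv0⟩
  · have h1 := exp_apply_eq_smul hLv
    have h2 : NormedSpace.exp L (v : V) = z • (v : V) := Module.End.mem_eigenspace_iff.1 v.2
    exact smul_left_injective ℂ hv0 (h1.symm.trans h2)

theorem tendsto_exp_pow_of_forall_spectrum_re_neg {L : V →L[ℂ] V}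
    (h : ∀ z ∈ spectrum ℂ L, z.re < 0) :
    Tendsto (fun n : ℕ => NormedSpace.exp L ^ n) atTop (𝓝 0) := by
  have : CompleteSpace V := FiniteDimensional.complete ℂ V
  rcases subsingleton_or_nontrivial V with hV | hV
  · have : ∀ n : ℕ, NormedSpace.exp L ^ n = 0 := fun n => by
      ext v; exact Subsingleton.elim _ _
    simp [this]
  · refine tendsto_pow_of_spectralRadius_lt_one ?_
    rw [← ENNReal.coe_one]
    refine spectrum.spectralRadius_lt_of_forall_lt _ fun z hz => ?_
    obtain ⟨μ, hμ, rfl⟩ := exists_exp_eq_of_mem_spectrum_exp hz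
    rw [← NNReal.coe_lt_coe, coe_nnnorm, Complex.norm_exp, NNReal.coe_one]
    exact Real.exp_lt_one_iff.2 (h μ hμ)

variable {q : ℕ}

theorem continuous_matOp : Continuous (matOp (q := q)) :=
  LinearMap.continuous_of_finiteDimensional
    (Matrix.toEuclideanCLM (n := Fin q) (𝕜 := ℝ)).toAlgEquiv.toLinearMap

theorem matOp_exp (M : Matrix (Fin q) (Fin q) ℝ) :
    matOp (NormedSpace.exp M) = NormedSpace.exp (matOp M) := by
  let : NormedRing (Matrix (Fin q) (Fin q) ℝ) := Matrix.linftyOpNormedRing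
  let : NormedAlgebra ℝ (Matrix (Fin q) (Fin q) ℝ) := Matrix.linftyOpNormedAlgebra
  let : NormedAlgebra ℚ (Matrix (Fin q) (Fin q) ℝ) := NormedAlgebra.restrictScalars ℚ ℝ _
  exact NormedSpace.map_exp (Matrix.toEuclideanCLM (n := Fin q) (𝕜 := ℝ)) continuous_matOp M

/-- The iterates of the time-one flow of a Hurwitz matrix tend to zero. -/
theorem IsHurwitz.tendsto_exp_pow {M : Matrix (Fin q) (Fin q) ℝ} (hM : IsHurwitz M) :
    Tendsto (fun n : ℕ => NormedSpace.exp (matOp M) ^ n) atTop (𝓝 0) := by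
  let φ := Matrix.toEuclideanCLM (n := Fin q) (𝕜 := ℂ)
  let ι : Matrix (Fin q) (Fin q) ℝ →+* Matrix (Fin q) (Fin q) ℂ := Complex.ofRealHom.mapMatrix
  have hφ : Continuous φ := φ.toAlgEquiv.toLinearMap.continuous_of_finiteDimensional
  have hφ' : Continuous φ.symm :=
    φ.symm.toAlgEquiv.toLinearMap.continuous_of_finiteDimensional
  have hι : Continuous ι := continuous_id.matrix_map Complex.continuous_ofReal
  -- The Hurwitz condition concerns complex eigenvalues, so decay is proved for the complexified
  -- operator and brought back by taking entrywise real parts.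
  have h1 : Tendsto (fun n : ℕ => NormedSpace.exp (φ (ι M)) ^ n) atTop (𝓝 0) := by
    refine tendsto_exp_pow_of_forall_spectrum_re_neg fun z hz => hM z ?_
    rwa [AlgEquiv.spectrum_eq φ] at hz
  have hexp : NormedSpace.exp (φ (ι M)) = φ (ι (NormedSpace.exp M)) := by
    -- The norm is auxiliary: the exponential depends only on the ring structure and the topology.
    let : NormedRing (Matrix (Fin q) (Fin q) ℂ) := Matrix.linftyOpNormedRing
    let : NormedAlgebra ℂ (Matrix (Fin q) (Fin q) ℂ) := Matrix.linftyOpNormedAlgebra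
    let : NormedAlgebra ℚ (Matrix (Fin q) (Fin q) ℂ) := NormedAlgebra.restrictScalars ℚ ℂ _
    let : NormedRing (Matrix (Fin q) (Fin q) ℝ) := Matrix.linftyOpNormedRing
    let : NormedAlgebra ℝ (Matrix (Fin q) (Fin q) ℝ) := Matrix.linftyOpNormedAlgebra
    let : NormedAlgebra ℚ (Matrix (Fin q) (Fin q) ℝ) := NormedAlgebra.restrictScalars ℚ ℝ _
    exact ((congrArg φ (NormedSpace.map_exp ι hι M)).trans (NormedSpace.map_exp φ hφ (ι M))).symm
  have h2 : Tendsto (fun n : ℕ => ι (NormedSpace.exp M ^ n)) atTop (𝓝 0) := by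
    have := (hφ'.tendsto 0).comp h1
    rw [map_zero] at this
    refine this.congr fun n => ?_
    simp only [Function.comp, hexp, ← map_pow]
    exact φ.symm_apply_apply _
  have h3 : Tendsto (fun n : ℕ => NormedSpace.exp M ^ n) atTop (𝓝 0) := by
    have hre : Continuous fun N : Matrix (Fin q) (Fin q) ℂ => N.map Complex.re :=
      continuous_id.matrix_map Complex.continuous_re
    have := (hre.tendsto 0).comp h2
    have h0 : (0 : Matrix (Fin q) (Fin q) ℂ).map Complex.re = 0 := by ext; simp
    rw [h0] at this
    refine this.congr fun n => ?_
    ext i j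
    simp [ι]
  have h4 := (continuous_matOp.tendsto 0).comp h3
  have h0 : matOp (0 : Matrix (Fin q) (Fin q) ℝ) = 0 := map_zero (Matrix.toEuclideanCLM (n := Fin q) (𝕜 := ℝ))
  rw [h0] at h4
  refine h4.congr fun n => ?_
  rw [← matOp_exp]
  exact map_pow (Matrix.toEuclideanCLM (n := Fin q) (𝕜 := ℝ)) _ _

end HurwitzDecay

/-! ### Uniform decay over a compact set of generators -/

section UniformDecay

open Filter Topology

variable {E : Type*} [NormedAddCommGroup E] [NormedSpace ℝ E] [CompleteSpace E]

theorem flow_natCast (L : E →L[ℝ] E) (n : ℕ) : flow L n = NormedSpace.exp L ^ n := by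
  induction n with
  | zero => simp [flow_zero]
  | succ n ih => rw [Nat.cast_succ, flow_add, ih, pow_succ]; simp [flow]

theorem continuous_flow_left (s : ℝ) : Continuous fun L : E →L[ℝ] E => flow L s := by
  let : NormedAlgebra ℚ (E →L[ℝ] E) := NormedAlgebra.restrictScalars ℚ ℝ _
  exact NormedSpace.exp_continuous.comp (continuous_const_smul s)

/-- Writing `s = n N + r` with `0 ≤ r < N`, each block of length `N` halves the norm. Rounding `s /
N` down to `n` costs the factor `2`, and the remainder `r` costs `e^{NR}`. -/
theorem norm_flow_le_of_norm_flow_natCast_le {L : E →L[ℝ] E} {R : ℝ} {N : ℕ} (hN : 0 < N)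
    (hL : ‖L‖ ≤ R) (h : ‖flow L N‖ ≤ 1 / 2) {s : ℝ} (hs : 0 ≤ s) :
    ‖flow L s‖ ≤ 2 * Real.exp (N * R) * Real.exp (-(Real.log 2 / N) * s) := by
  have hN' : (0 : ℝ) < N := by exact_mod_cast hN
  have step : ∀ (n : ℕ) (r : ℝ), 0 ≤ r → r ≤ N →
      ‖flow L (n * N + r)‖ ≤ (1 / 2) ^ n * Real.exp (N * R) := by
    intro n r hr hrN
    induction n with
    | zero => simpa using norm_flow_le hL (by rwa [abs_of_nonneg hr])
    | succ n ih =>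
      rw [show ((n + 1 : ℕ) : ℝ) * N + r = N + (n * N + r) by push_cast; ring, flow_add, pow_succ']
      calc _ ≤ ‖flow L N‖ * ‖flow L (n * N + r)‖ := norm_mul_le _ _
        _ ≤ 1 / 2 * ((1 / 2) ^ n * Real.exp (N * R)) := by gcongr
        _ = _ := by ring
  set n := ⌊s / N⌋₊ with hn
  have h1 : (n : ℝ) ≤ s / N := Nat.floor_le (by positivity)
  have h2 : s / N < n + 1 := Nat.lt_floor_add_one _
  have h1' : n * N ≤ s := (le_div_iff₀ hN').1 h1
  have h2' : s < (n + 1) * N := (div_lt_iff₀ hN').1 h2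
  have h3 := step n (s - n * N) (by linarith) (by linarith)
  rw [add_sub_cancel] at h3
  have h4 : ((1 : ℝ) / 2) ^ n ≤ 2 * Real.exp (-(Real.log 2 / N) * s) := by
    have e1 : ((1 : ℝ) / 2) ^ (n + 1) = Real.exp (-(Real.log 2 * (n + 1))) := by
      rw [one_div, inv_pow, Real.exp_neg, ← Real.rpow_natCast, Real.rpow_def_of_pos two_pos]
      push_cast; rfl
    have e2 : ((1 : ℝ) / 2) ^ n = 2 * (1 / 2) ^ (n + 1) := by rw [pow_succ]; ring
    rw [e2, e1]
    have : Real.log 2 * (s / N) ≤ Real.log 2 * (n + 1) :=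
      mul_le_mul_of_nonneg_left h2.le (Real.log_nonneg one_le_two)
    have e3 : -(Real.log 2 / N) * s = -(Real.log 2 * (s / N)) := by ring
    rw [e3]
    gcongr
  calc _ ≤ _ := h3
    _ ≤ 2 * Real.exp (-(Real.log 2 / N) * s) * Real.exp (N * R) := by gcongr
    _ = _ := by ring

/-- The flows of a compact set of exponentially stable operators decay uniformly. -/
theorem IsCompact.exists_uniform_exponential_decay {𝒦 : Set (E →L[ℝ] E)} (h𝒦 : IsCompact 𝒦)
    (h : ∀ L ∈ 𝒦, Tendsto (fun n : ℕ => NormedSpace.exp L ^ n) atTop (𝓝 0)) :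
    ∃ M > 0, ∃ μ > 0, ∀ L ∈ 𝒦, ∀ s, 0 ≤ s → ‖flow L s‖ ≤ M * Real.exp (-μ * s) := by
  refine h𝒦.induction_on
    (p := fun t => ∃ M > 0, ∃ μ > 0, ∀ L ∈ t, ∀ s, 0 ≤ s → ‖flow L s‖ ≤ M * Real.exp (-μ * s))
    ?_ ?_ ?_ ?_
  · exact ⟨1, one_pos, 1, one_pos, by simp⟩
  · rintro s t hst ⟨M, hM, μ, hμ, H⟩
    exact ⟨M, hM, μ, hμ, fun L hL => H L (hst hL)⟩
  · rintro s t ⟨M, hM, μ, hμ, H⟩ ⟨M', hM', μ', hμ', H'⟩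
    have key : ∀ {m ν : ℝ} {L : E →L[ℝ] E} {r : ℝ}, m ≤ max M M' → min μ μ' ≤ ν → 0 ≤ r →
        ‖flow L r‖ ≤ m * Real.exp (-ν * r) →
        ‖flow L r‖ ≤ max M M' * Real.exp (-(min μ μ') * r) := by
      intro m ν L r hm hν hr hb
      refine hb.trans (mul_le_mul hm (Real.exp_le_exp.2 ?_) (Real.exp_nonneg _)
        (hM.le.trans (le_max_left _ _)))
      exact mul_le_mul_of_nonneg_right (neg_le_neg hν) hr
    refine ⟨max M M', lt_max_of_lt_left hM, min μ μ', lt_min hμ hμ', ?_⟩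
    rintro L (hL | hL) r hr
    · exact key (le_max_left _ _) (min_le_left _ _) hr (H L hL r hr)
    · exact key (le_max_right _ _) (min_le_right _ _) hr (H' L hL r hr)
  · intro L hL
    -- Local step: a time `N` with `‖e^{NL}‖ < 1/2` serves a whole neighbourhood of `L`, with the
    -- same constants.
    have hev := (h L hL).norm.eventually_lt_const (u := (1 / 2 : ℝ)) (by simp)
    obtain ⟨N, hN, hN0⟩ := (hev.and (eventually_gt_atTop 0)).exists
    rw [← flow_natCast] at hN
    have hN0' : (0 : ℝ) < N := by exact_mod_cast hN0
    have o1 : {L' : E →L[ℝ] E | ‖flow L' N‖ < 1 / 2} ∈ 𝓝 L :=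
      (continuous_flow_left (N : ℝ)).norm.continuousAt.eventually_lt_const hN
    have o2 : {L' : E →L[ℝ] E | ‖L'‖ < ‖L‖ + 1} ∈ 𝓝 L :=
      continuous_norm.continuousAt.eventually_lt_const (lt_add_one _)
    refine ⟨_, mem_nhdsWithin_of_mem_nhds (inter_mem o1 o2), 2 * Real.exp (N * (‖L‖ + 1)),
      by positivity, Real.log 2 / N, div_pos (Real.log_pos one_lt_two) hN0', ?_⟩
    rintro L' ⟨h1, h2⟩ s hs
    exact norm_flow_le_of_norm_flow_natCast_le hN0 (le_of_lt h2) (le_of_lt h1) hs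

end UniformDecay

/-! ### Solvability of the Lyapunov equation -/

section Lyapunov

open Filter Topology

variable {E : Type*} [NormedAddCommGroup E] [InnerProductSpace ℝ E]

theorem tendsto_inner_flow {L : E →L[ℝ] E} (hL : ∀ x, Tendsto (fun s => flow L s x) atTop (𝓝 0))
    (S : E →L[ℝ] E) (x y : E) :
    Tendsto (fun s => inner ℝ (flow L s x) (S (flow L s y))) atTop (𝓝 0) := by
  simpa using (hL x).inner (𝕜 := ℝ) ((S.continuous.tendsto 0).comp (hL y))

variable [CompleteSpace E]

theorem hasDerivAt_inner_flow {L L' S Q : E →L[ℝ] E} (hadj : ∀ x y, inner ℝ (L x) y = inner ℝ x (L' y))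
    (h : L' * S + S * L = -Q) (x y : E) (s : ℝ) :
    HasDerivAt (fun s => inner ℝ (flow L s x) (S (flow L s y)))
      (-inner ℝ (flow L s x) (Q (flow L s y))) s := by
  have hx : ∀ z, HasDerivAt (fun s => flow L s z) (L (flow L s z)) s := fun z => by
    simpa using (hasDerivAt_flow' L s).clm_apply (hasDerivAt_const s z)
  have hS : HasDerivAt (fun s => S (flow L s y)) (S (L (flow L s y))) s :=
    S.hasFDerivAt.comp_hasDerivAt s (hx y)
  refine ((hx x).inner ℝ hS).congr_deriv ?_
  rw [hadj, ← inner_add_right, ← inner_neg_right]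
  congr 1
  have := DFunLike.congr_fun h (flow L s y)
  rw [add_comm]
  exact this

/-- The bilinear form of `S` is constant along the flow and tends to zero. -/
theorem lyapunov_eq_zero {L L' S : E →L[ℝ] E} (hadj : ∀ x y, inner ℝ (L x) y = inner ℝ x (L' y))
    (hL : ∀ x, Tendsto (fun s => flow L s x) atTop (𝓝 0)) (h : L' * S + S * L = 0) : S = 0 := by
  ext x
  refine ext_inner_left ℝ fun y => ?_
  have hd : ∀ s, HasDerivAt (fun s => inner ℝ (flow L s y) (S (flow L s x))) 0 s := fun s => by
    simpa using hasDerivAt_inner_flow (Q := 0) hadj (by rw [h, neg_zero]) y x s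
  have hconst : ∀ s, inner ℝ (flow L s y) (S (flow L s x)) = inner ℝ y (S x) := fun s => by
    have := is_const_of_deriv_eq_zero (fun s => (hd s).differentiableAt) (fun s => (hd s).deriv) s 0
    simpa [flow_zero] using this
  have := tendsto_inner_flow hL S y x
  simp only [hconst] at this
  simpa using tendsto_nhds_unique tendsto_const_nhds this

/-- Along the flow the quadratic form has derivative `-‖e^{sL} x‖²`, which never vanishes because
the flow is invertible. A strictly decreasing function with limit `0` is positive at time `0`. -/
theorem lyapunov_inner_pos {L L' S : E →L[ℝ] E} (hadj : ∀ x y, inner ℝ (L x) y = inner ℝ x (L' y))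
    (hL : ∀ x, Tendsto (fun s => flow L s x) atTop (𝓝 0)) (h : L' * S + S * L = -1) {x : E}
    (hx : x ≠ 0) : 0 < inner ℝ x (S x) := by
  have hd := hasDerivAt_inner_flow hadj h x x
  have hanti : StrictAnti fun s => inner ℝ (flow L s x) (S (flow L s x)) := by
    refine strictAnti_of_deriv_neg fun s => ?_
    rw [(hd s).deriv, one_apply_eq_self, neg_lt_zero, real_inner_self_eq_norm_sq]
    refine pow_pos (norm_pos_iff.2 fun h0 => hx ?_) 2
    have := flow_flow_apply L (-s) s x
    rwa [h0, map_zero, neg_add_cancel, flow_zero, one_apply_eq_self, eq_comm] at this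
  have h1 := hanti.antitone.le_of_tendsto (tendsto_inner_flow hL S x x) 1
  have h2 := hanti one_pos
  simp only [flow_zero, one_apply_eq_self] at h1 h2
  exact h1.trans_lt h2

variable {q : ℕ}

theorem IsHurwitz.tendsto_flow {M : Matrix (Fin q) (Fin q) ℝ} (hM : IsHurwitz M) (x : State q) :
    Tendsto (fun s => flow (matOp M) s x) atTop (𝓝 0) := by
  obtain ⟨c, _, μ, hμ, H⟩ := (isCompact_singleton (x := matOp M)).exists_uniform_exponential_decay
    (by rintro _ rfl; exact hM.tendsto_exp_pow)
  have h1 : Tendsto (fun s : ℝ => c * Real.exp (-μ * s) * ‖x‖) atTop (𝓝 0) := by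
    have h0 : Tendsto (fun s : ℝ => Real.exp (-μ * s)) atTop (𝓝 0) :=
      Real.tendsto_exp_atBot.comp (tendsto_id.const_mul_atTop_of_neg (neg_lt_zero.2 hμ))
    simpa using (h0.const_mul c).mul_const ‖x‖
  refine squeeze_zero_norm' ?_ h1
  filter_upwards [eventually_ge_atTop 0] with s hs
  exact ((flow (matOp M) s).le_opNorm x).trans
    (mul_le_mul_of_nonneg_right (H _ rfl s hs) (norm_nonneg _))

/-- The Lyapunov operator `S ↦ Mᵀ S + S M`. -/
def lyapunovMap (M : Matrix (Fin q) (Fin q) ℝ) :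
    Matrix (Fin q) (Fin q) ℝ →ₗ[ℝ] Matrix (Fin q) (Fin q) ℝ where
  toFun S := M.transpose * S + S * M
  map_add' S T := by simp only [mul_add, add_mul]; abel
  map_smul' c S := by simp

theorem matOp_lyapunovMap (M S : Matrix (Fin q) (Fin q) ℝ) :
    matOp M.transpose * matOp S + matOp S * matOp M = matOp (lyapunovMap M S) := by
  simp [matOp, lyapunovMap]

theorem inner_matOp_left (M : Matrix (Fin q) (Fin q) ℝ) (x y : State q) :
    inner ℝ (matOp M x) y = inner ℝ x (matOp M.transpose y) := by
  have h : matOp M.transpose = ContinuousLinearMap.adjoint (matOp M) := by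
    rw [← Matrix.conjTranspose_eq_transpose_of_trivial]
    exact map_star (Matrix.toEuclideanCLM (n := Fin q) (𝕜 := ℝ)) M
  rw [h, ContinuousLinearMap.adjoint_inner_right]

theorem matOp_injective : Function.Injective (matOp (q := q)) :=
  (Matrix.toEuclideanCLM (n := Fin q) (𝕜 := ℝ)).injective

theorem IsHurwitz.lyapunovMap_injective {M : Matrix (Fin q) (Fin q) ℝ} (hM : IsHurwitz M) :
    Function.Injective (lyapunovMap M) := by
  refine (injective_iff_map_eq_zero _).2 fun S hS => matOp_injective ?_
  have h0 : matOp (0 : Matrix (Fin q) (Fin q) ℝ) = 0 :=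
    map_zero (Matrix.toEuclideanCLM (n := Fin q) (𝕜 := ℝ))
  rw [h0]
  exact lyapunov_eq_zero (inner_matOp_left M) hM.tendsto_flow (by rw [matOp_lyapunovMap, hS, h0])

/-- In finite dimension injectivity of the Lyapunov operator gives a solution for `Q = 1`. Its
transpose solves the same equation, so uniqueness makes it symmetric. -/
theorem IsHurwitz.exists_isLyapunovPair {M : Matrix (Fin q) (Fin q) ℝ} (hM : IsHurwitz M) :
    ∃ S Q : Matrix (Fin q) (Fin q) ℝ, IsLyapunovPair M S Q := by
  obtain ⟨S, hS⟩ := LinearMap.injective_iff_surjective.1 hM.lyapunovMap_injective (-1)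
  have hsymm : S.transpose = S := by
    refine hM.lyapunovMap_injective ?_
    rw [hS, ← Matrix.transpose_one, ← Matrix.transpose_neg, ← hS]
    simp [lyapunovMap, add_comm]
  refine ⟨S, 1, Matrix.posDef_iff_dotProduct_mulVec.2 ⟨?_, fun x hx => ?_⟩, Matrix.PosDef.one, hS⟩
  · rw [Matrix.IsHermitian, Matrix.conjTranspose_eq_transpose_of_trivial, hsymm]
  · have h1 : matOp (-1 : Matrix (Fin q) (Fin q) ℝ) = -1 := by simp [matOp]
    have := lyapunov_inner_pos (inner_matOp_left M) hM.tendsto_flow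
      (S := matOp S) (by rw [matOp_lyapunovMap, hS, h1]) (x := WithLp.toLp 2 x) (by simpa using hx)
    rw [matOp, Matrix.toEuclideanCLM_toLp, EuclideanSpace.inner_toLp_toLp] at this
    simpa [dotProduct_comm] using this

end Lyapunov

/-! ### The `L²` norm of the input history -/

section Scalar

/-- The `L²` norm of the piece of `U` on `[s - D, s]`. -/
noncomputable def historyNorm (D : ℝ) (U : ℝ → ℝ) (s : ℝ) : ℝ := √(∫ θ in (s - D)..s, U θ ^ 2)

theorem historyNorm_nonneg (D : ℝ) (U : ℝ → ℝ) (s : ℝ) : 0 ≤ historyNorm D U s := Real.sqrt_nonneg _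

theorem intervalIntegrable_of_memLp_two {U : ℝ → ℝ} {α β c d : ℝ}
    (hU : MemLp U 2 (volume.restrict (Icc α β))) (hc : c ∈ Icc α β) (hd : d ∈ Icc α β) :
    IntervalIntegrable U volume c d := by
  have : IntegrableOn U (Icc α β) := hU.integrable one_le_two
  exact (intervalIntegrable_iff.2 (this.mono_set
    (uIoc_subset_uIcc.trans (ordConnected_Icc.uIcc_subset hc hd))))

theorem intervalIntegrable_sq_of_memLp_two {U : ℝ → ℝ} {α β c d : ℝ}
    (hU : MemLp U 2 (volume.restrict (Icc α β))) (hc : c ∈ Icc α β) (hd : d ∈ Icc α β) :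
    IntervalIntegrable (fun θ => U θ ^ 2) volume c d := by
  have : IntegrableOn (fun θ => U θ ^ 2) (Icc α β) := hU.integrable_sq
  exact (intervalIntegrable_iff.2 (this.mono_set
    (uIoc_subset_uIcc.trans (ordConnected_Icc.uIcc_subset hc hd))))

/-- Cauchy-Schwarz on an interval of length `D`. -/
theorem integral_abs_le_sqrt_mul_historyNorm {D s : ℝ} (hD : 0 < D) {U : ℝ → ℝ}
    (h1 : IntervalIntegrable U volume (s - D) s)
    (h2 : IntervalIntegrable (fun θ => U θ ^ 2) volume (s - D) s) :
    ∫ θ in (s - D)..s, |U θ| ≤ √D * historyNorm D U s := by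
  have hle : s - D ≤ s := by linarith
  set n := ∫ θ in (s - D)..s, |U θ| with hn
  -- Cauchy–Schwarz as nonnegativity of a variance: `n / D` is the mean of `|U|`.
  have key : 0 ≤ ∫ θ in (s - D)..s, (|U θ| - n / D) ^ 2 :=
    intervalIntegral.integral_nonneg hle fun _ _ => sq_nonneg _
  have e : ∀ θ, (|U θ| - n / D) ^ 2 = U θ ^ 2 - 2 * (n / D) * |U θ| + (n / D) ^ 2 := fun θ => by
    rw [sub_sq, sq_abs]; ring
  simp only [e] at key
  rw [intervalIntegral.integral_add (h2.sub (h1.abs.const_mul _)) intervalIntegrable_const,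
    intervalIntegral.integral_sub h2 (h1.abs.const_mul _), intervalIntegral.integral_const_mul,
    ← hn, intervalIntegral.integral_const, smul_eq_mul, sub_sub_cancel] at key
  have h3 : n ^ 2 ≤ D * ∫ θ in (s - D)..s, U θ ^ 2 := by
    have : D * (n / D) ^ 2 = n / D * n := by field_simp
    have h4 : n / D * n ≤ ∫ θ in (s - D)..s, U θ ^ 2 := by linarith
    calc n ^ 2 = D * (n / D * n) := by field_simp
      _ ≤ _ := by gcongr
  rw [historyNorm, ← Real.sqrt_mul hD.le]
  exact Real.le_sqrt_of_sq_le h3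

theorem continuousOn_historyNorm {D a b : ℝ} (hD : 0 ≤ D) {U : ℝ → ℝ}
    (hU : MemLp U 2 (volume.restrict (Icc (a - D) b))) :
    ContinuousOn (historyNorm D U) (Icc a b) := by
  rcases lt_or_ge b a with hab | hab
  · simp [Icc_eq_empty_of_lt hab]
  have hl : a - D ∈ Icc (a - D) b := ⟨le_rfl, by linarith⟩
  have hi : IntervalIntegrable (fun θ => U θ ^ 2) volume (a - D) b :=
    intervalIntegrable_sq_of_memLp_two hU hl ⟨by linarith, le_rfl⟩
  have hc : ContinuousOn (fun s => ∫ θ in (a - D)..s, U θ ^ 2) (Icc (a - D) b) := by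
    have := intervalIntegral.continuousOn_primitive_interval' hi left_mem_uIcc
    rwa [uIcc_of_le (by linarith)] at this
  refine Real.continuous_sqrt.comp_continuousOn ?_
  have h1 : ContinuousOn (fun s => (∫ θ in (a - D)..s, U θ ^ 2) - ∫ θ in (a - D)..(s - D), U θ ^ 2)
      (Icc a b) := by
    refine (hc.mono (Icc_subset_Icc_left (by linarith))).sub
      (hc.comp (by fun_prop) fun s hs => ⟨?_, ?_⟩) <;> linarith [hs.1, hs.2]
  refine h1.congr fun s hs => ?_
  have hsD : s - D ∈ Icc (a - D) b := ⟨by linarith [hs.1], by linarith [hs.2]⟩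
  have hs' : s ∈ Icc (a - D) b := ⟨by linarith [hs.1], hs.2⟩
  exact (intervalIntegral.integral_interval_sub_left
    (intervalIntegrable_sq_of_memLp_two hU hl hs')
    (intervalIntegrable_sq_of_memLp_two hU hl hsD)).symm

end Scalar

/-! ### The exact predictor and its delay-free dynamics -/

section Predictor

variable {E : Type*} [NormedAddCommGroup E] [InnerProductSpace ℝ E]

/-- The closed-loop generator `L + B K`. -/
noncomputable def closedLoop (L : E →L[ℝ] E) (B K : E) : E →L[ℝ] E :=
  L + (innerSL ℝ K).smulRight B

theorem closedLoop_apply (L : E →L[ℝ] E) (B K x : E) :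
    closedLoop L B K x = L x + inner ℝ K x • B := by
  simp [closedLoop]

variable [CompleteSpace E]

/-- The input `t ↦ ∫ U(θ) e^{L (c - θ)} B dθ` under the flow of `L`. -/
theorem flow_apply_integral (L : E →L[ℝ] E) (B : E) {U : ℝ → ℝ} {α β : ℝ}
    (hU : IntervalIntegrable U volume α β) (r c : ℝ) :
    flow L r (∫ θ in α..β, U θ • flow L (c - θ) B) =
      ∫ θ in α..β, U θ • flow L (r + c - θ) B := by
  have hc := continuous_flow L
  rw [← ContinuousLinearMap.intervalIntegral_comp_comm]
  · simp only [map_smul, flow_flow_apply, add_sub_assoc]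
  · exact hU.smul_continuousOn (by fun_prop)

theorem intervalIntegrable_smul_flow (L : E →L[ℝ] E) (B : E) {U : ℝ → ℝ} {α β : ℝ}
    (hU : IntervalIntegrable U volume α β) (c : ℝ) :
    IntervalIntegrable (fun θ => U θ • flow L (c - θ) B) volume α β := by
  have hc := continuous_flow L
  exact hU.smul_continuousOn (by fun_prop)

/-- The exact prediction at time `s` of the state at time `s + D`. -/
noncomputable def predictor (L : E →L[ℝ] E) (B : E) (D : ℝ) (X : ℝ → E) (U : ℝ → ℝ) (s : ℝ) : E :=
  flow L D (X s) + ∫ θ in (s - D)..s, U θ • flow L (s - θ) B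

/-- `(X, U)` satisfies `X' = L X + U(· - D) B` on `[a, b]`, in integrated form. -/
structure IsModeSolution (L : E →L[ℝ] E) (B : E) (D a b : ℝ) (X : ℝ → E) (U : ℝ → ℝ) : Prop where
  continuousOn : ContinuousOn X (Icc a b)
  memLp : MemLp U 2 (volume.restrict (Icc (a - D) b))
  plant : ∀ s ∈ Icc a b, X s = X a + ∫ r in a..s, (L (X r) + U (r - D) • B)

namespace IsModeSolution

variable {L : E →L[ℝ] E} {B : E} {D a b : ℝ} {X : ℝ → E} {U : ℝ → ℝ}

theorem state_eq (h : IsModeSolution L B D a b X U) (hD : 0 ≤ D) {s : ℝ} (hs : s ∈ Icc a b) :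
    X s = flow L (s - a) (X a) + ∫ θ in (a - D)..(s - D), U θ • flow L (s - D - θ) B := by
  have hi : IntervalIntegrable U volume (a - D) (s - D) := intervalIntegrable_of_memLp_two h.memLp
    ⟨le_rfl, by linarith [hs.1, hs.2]⟩ ⟨by linarith [hs.1], by linarith [hs.2]⟩
  have hi' : IntervalIntegrable (fun r => U (r - D) • B) volume a s := by
    have := hi.comp_sub_right D
    simp only [sub_add_cancel] at this
    exact this.smul_continuousOn continuousOn_const
  have := eq_flow_add_integral_of_integral_eq hs.1
    (h.continuousOn.mono (Icc_subset_Icc_right hs.2)) hi'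
    fun r hr => h.plant r ⟨hr.1, hr.2.trans hs.2⟩
  rw [this, ← intervalIntegral.integral_comp_sub_right
    (fun θ => U θ • flow L (s - D - θ) B)]
  simp [sub_sub_sub_cancel_right]

/-- The delay disappears here. Applying `e^{LD}` to the formula for `X(s)` gives the input integral
over `[a-D, s-D]`; it joins the predictor's own integral over `[s-D, s]`, and cutting the result at
`a` isolates the predictor at `a`. -/
theorem predictor_eq (h : IsModeSolution L B D a b X U) (hD : 0 ≤ D) {s : ℝ} (hs : s ∈ Icc a b) :
    predictor L B D X U s =
      flow L (s - a) (predictor L B D X U a) + ∫ θ in a..s, flow L (s - θ) (U θ • B) := by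
  have hmem : ∀ r ∈ Icc (a - D) s, r ∈ Icc (a - D) b := fun r hr => ⟨hr.1, hr.2.trans hs.2⟩
  have hi : ∀ c ∈ Icc (a - D) s, ∀ d ∈ Icc (a - D) s, IntervalIntegrable U volume c d :=
    fun c hc d hd => intervalIntegrable_of_memLp_two h.memLp (hmem c hc) (hmem d hd)
  have m1 : a - D ∈ Icc (a - D) s := ⟨le_rfl, by linarith [hs.1]⟩
  have m2 : a ∈ Icc (a - D) s := ⟨by linarith, hs.1⟩
  have m3 : s - D ∈ Icc (a - D) s := ⟨by linarith [hs.1], by linarith⟩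
  have m4 : s ∈ Icc (a - D) s := ⟨by linarith [hs.1], le_rfl⟩
  have hg : ∀ c ∈ Icc (a - D) s, ∀ d ∈ Icc (a - D) s,
      IntervalIntegrable (fun θ => U θ • flow L (s - θ) B) volume c d :=
    fun c hc d hd => intervalIntegrable_smul_flow L B (hi c hc d hd) s
  rw [predictor, predictor, h.state_eq hD hs, map_add, map_add, flow_flow_apply, flow_flow_apply,
    flow_apply_integral L B (hi _ m1 _ m3), flow_apply_integral L B (hi _ m1 _ m2),
    show D + (s - a) = s - a + D by ring, show D + (s - D) = s by ring,
    show s - a + a = s by ring, add_assoc, add_assoc]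
  congr 1
  simp only [map_smul]
  rw [intervalIntegral.integral_add_adjacent_intervals (hg _ m1 _ m3) (hg _ m3 _ m4),
    intervalIntegral.integral_add_adjacent_intervals (hg _ m1 _ m2) (hg _ m2 _ m4)]

theorem continuousOn_predictor (h : IsModeSolution L B D a b X U) (hD : 0 ≤ D) :
    ContinuousOn (predictor L B D X U) (Icc a b) := by
  rcases lt_or_ge b a with hab | hab
  · simp [Icc_eq_empty_of_lt hab]
  have hi : IntervalIntegrable U volume a b := intervalIntegrable_of_memLp_two h.memLp
    ⟨by linarith, hab⟩ ⟨by linarith, le_rfl⟩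
  have hg := intervalIntegrable_smul_flow L B hi a
  have hp := intervalIntegral.continuousOn_primitive_interval' hg left_mem_uIcc
  rw [uIcc_of_le hab] at hp
  have hc := continuous_flow L
  have : ContinuousOn (fun s => flow L (s - a) (predictor L B D X U a +
      ∫ θ in a..s, U θ • flow L (a - θ) B)) (Icc a b) :=
    (by fun_prop : ContinuousOn (fun s => flow L (s - a)) (Icc a b)).clm_apply
      (continuousOn_const.add hp)
  refine this.congr fun s hs => ?_
  beta_reduce
  rw [h.predictor_eq hD hs, map_add, flow_apply_integral L B
    (hi.mono_set (by rw [uIcc_of_le hs.1, uIcc_of_le hab]; exact Icc_subset_Icc_right hs.2))]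
  simp

end IsModeSolution

/-- The prediction of the state evolves under the closed-loop generator, perturbed by the deviation
of the input from the nominal feedback. -/
theorem IsModeSolution.predictor_eq_closedLoop {L : E →L[ℝ] E} {B : E} {D a b : ℝ} {X : ℝ → E}
    {U : ℝ → ℝ} (h : IsModeSolution L B D a b X U) (hD : 0 ≤ D) (K : E) {s : ℝ}
    (hs : s ∈ Icc a b) :
    predictor L B D X U s = flow (closedLoop L B K) (s - a) (predictor L B D X U a) +
      ∫ r in a..s, flow (closedLoop L B K) (s - r)
        ((U r - inner ℝ K (predictor L B D X U r)) • B) := by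
  have hab := hs.1.trans hs.2
  have hi : IntervalIntegrable U volume a b := intervalIntegrable_of_memLp_two h.memLp
    ⟨by linarith, hab⟩ ⟨by linarith, le_rfl⟩
  have hP := h.continuousOn_predictor hD
  have hPs : ContinuousOn (predictor L B D X U) (Icc a s) := hP.mono (Icc_subset_Icc_right hs.2)
  have hsub : uIcc a s ⊆ uIcc a b := by
    rw [uIcc_of_le hs.1, uIcc_of_le hab]; exact Icc_subset_Icc_right hs.2
  have hKP : IntervalIntegrable (fun r => inner ℝ K (predictor L B D X U r)) volume a s := by
    refine ContinuousOn.intervalIntegrable ?_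
    rw [uIcc_of_le hs.1]
    exact continuousOn_const.inner hPs
  -- Pass from the mild form to the integral equation of `P' = L P + U B`, regroup it as `(L + B K)
  -- P + (U - K P) B`, and return to the mild form for the new generator.
  have h1 := integral_eq_of_eq_flow_add_integral (hi.smul_continuousOn (g := fun _ => B) continuousOn_const)
    fun s hs => h.predictor_eq hD hs
  refine eq_flow_add_integral_of_integral_eq hs.1 hPs
    (((hi.mono_set hsub).sub hKP).smul_continuousOn (g := fun _ => B) continuousOn_const) fun r hr => ?_
  rw [h1 r ⟨hr.1, hr.2.trans hs.2⟩]
  congr 1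
  refine intervalIntegral.integral_congr fun θ _ => ?_
  simp only [closedLoop_apply, sub_smul]
  abel

end Predictor

/-! ### The averaged feedback as a perturbation of the exact one -/

section Perturbation

variable {E : Type*} [NormedAddCommGroup E]

/-- The norm of the state `(X(s), U|_[s - D, s])` of the delay system. -/
noncomputable def delayNorm (D : ℝ) (X : ℝ → E) (U : ℝ → ℝ) (s : ℝ) : ℝ :=
  ‖X s‖ + historyNorm D U s

theorem delayNorm_nonneg (D : ℝ) (X : ℝ → E) (U : ℝ → ℝ) (s : ℝ) : 0 ≤ delayNorm D X U s :=
  add_nonneg (norm_nonneg _) (historyNorm_nonneg _ _ _)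

theorem historyNorm_le_delayNorm (D : ℝ) (X : ℝ → E) (U : ℝ → ℝ) (s : ℝ) :
    historyNorm D U s ≤ delayNorm D X U s :=
  le_add_of_nonneg_left (norm_nonneg _)

theorem norm_le_delayNorm (D : ℝ) (X : ℝ → E) (U : ℝ → ℝ) (s : ℝ) :
    ‖X s‖ ≤ delayNorm D X U s :=
  le_add_of_nonneg_right (historyNorm_nonneg _ _ _)

theorem integral_abs_le_sqrt_mul_delayNorm {D s : ℝ} (hD : 0 < D) (X : ℝ → E) {U : ℝ → ℝ}
    (hU : MemLp U 2 (volume.restrict (Icc (s - D) s))) :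
    ∫ θ in (s - D)..s, |U θ| ≤ √D * delayNorm D X U s := by
  have m1 : s - D ∈ Icc (s - D) s := ⟨le_rfl, by linarith⟩
  have m2 : s ∈ Icc (s - D) s := ⟨by linarith, le_rfl⟩
  exact (integral_abs_le_sqrt_mul_historyNorm hD (intervalIntegrable_of_memLp_two hU m1 m2)
    (intervalIntegrable_sq_of_memLp_two hU m1 m2)).trans
    (mul_le_mul_of_nonneg_left (historyNorm_le_delayNorm _ _ _ _) (Real.sqrt_nonneg _))

variable [InnerProductSpace ℝ E]

theorem norm_integral_smul_le {U : ℝ → ℝ} {F : ℝ → E} {α β c d C : ℝ} (hαc : α ≤ c) (hcd : c ≤ d)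
    (hdβ : d ≤ β) (hC : 0 ≤ C) (hF : ∀ θ ∈ Icc c d, ‖F θ‖ ≤ C)
    (hU : IntervalIntegrable U volume α β) :
    ‖∫ θ in c..d, U θ • F θ‖ ≤ C * ∫ θ in α..β, |U θ| := by
  have hsub : uIcc c d ⊆ uIcc α β := by
    rw [uIcc_of_le hcd, uIcc_of_le (hαc.trans (hcd.trans hdβ))]; exact Icc_subset_Icc hαc hdβ
  have hU' := (hU.mono_set hsub).abs.const_mul C
  calc ‖∫ θ in c..d, U θ • F θ‖ ≤ ∫ θ in c..d, C * |U θ| := by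
        refine intervalIntegral.norm_integral_le_of_norm_le hcd (.of_forall fun θ hθ => ?_) hU'
        rw [norm_smul, Real.norm_eq_abs, mul_comm]
        exact mul_le_mul_of_nonneg_right (hF θ (Ioc_subset_Icc_self hθ)) (abs_nonneg _)
    _ = C * ∫ θ in c..d, |U θ| := intervalIntegral.integral_const_mul _ _
    _ ≤ _ := by
        refine mul_le_mul_of_nonneg_left ?_ hC
        exact intervalIntegral.integral_mono_interval hαc hcd hdβ
          (.of_forall fun _ => abs_nonneg _) hU.abs

/-- The prediction over the delay `D` that uses the mode `(L, B)` over the horizon `h` and the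
averaged mode `(Lbar, Bbar)` afterwards. -/
noncomputable def averagedPredictor (L : E →L[ℝ] E) (B : E) (Lbar : E →L[ℝ] E) (Bbar : E) (D : ℝ)
    (X : ℝ → E) (U : ℝ → ℝ) (h s : ℝ) : E :=
  flow Lbar (D - h) (flow L h (X s) + ∫ θ in (s - D)..(s + h - D), U θ • flow L (s + h - D - θ) B)
    + ∫ θ in (s + h - D)..s, U θ • flow Lbar (s - θ) Bbar

theorem norm_flow_apply_le {L : E →L[ℝ] E} {B : E} {R D r b : ℝ} (hL : ‖L‖ ≤ R) (hB : ‖B‖ ≤ b)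
    (hr : |r| ≤ D) : ‖flow L r B‖ ≤ Real.exp (D * R) * b :=
  ((flow L r).le_opNorm B).trans
    (mul_le_mul (norm_flow_le hL hr) hB (norm_nonneg _) (Real.exp_nonneg _))

theorem norm_predictor_le {L : E →L[ℝ] E} {B : E} {R D s : ℝ} (hD : 0 < D) (hL : ‖L‖ ≤ R)
    (hB : ‖B‖ ≤ R) {X : ℝ → E} {U : ℝ → ℝ} (hU : MemLp U 2 (volume.restrict (Icc (s - D) s))) :
    ‖predictor L B D X U s‖ ≤ Real.exp (D * R) * (1 + R * √D) * delayNorm D X U s := by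
  have hR : 0 ≤ R := (norm_nonneg _).trans hL
  have hi : IntervalIntegrable U volume (s - D) s :=
    intervalIntegrable_of_memLp_two hU ⟨le_rfl, by linarith⟩ ⟨by linarith, le_rfl⟩
  have h1 : ‖flow L D (X s)‖ ≤ Real.exp (D * R) * delayNorm D X U s :=
    norm_flow_apply_le hL (norm_le_delayNorm D X U s) (abs_of_pos hD).le
  have h2 : ‖∫ θ in (s - D)..s, U θ • flow L (s - θ) B‖ ≤
      Real.exp (D * R) * R * ∫ θ in (s - D)..s, |U θ| :=
    norm_integral_smul_le le_rfl (by linarith) le_rfl (by positivity)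
      (fun θ hθ => norm_flow_apply_le hL hB (by rw [abs_of_nonneg] <;> linarith [hθ.1, hθ.2])) hi
  have h3 := integral_abs_le_sqrt_mul_delayNorm hD X hU
  calc _ ≤ _ := norm_add_le _ _
    _ ≤ Real.exp (D * R) * delayNorm D X U s +
        Real.exp (D * R) * R * (√D * delayNorm D X U s) := by
      refine add_le_add h1 (h2.trans ?_)
      gcongr
    _ = _ := by ring

variable [CompleteSpace E]

/-- The state is recovered by flowing the prediction back over time `D`. Only the history norm
appears on the right, so a bound on `P` and on the input yields one on `X`. -/
theorem norm_le_predictor {L : E →L[ℝ] E} {B : E} {R D s : ℝ} (hD : 0 < D) (hL : ‖L‖ ≤ R)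
    (hB : ‖B‖ ≤ R) {X : ℝ → E} {U : ℝ → ℝ} (hU : MemLp U 2 (volume.restrict (Icc (s - D) s))) :
    ‖X s‖ ≤ Real.exp (D * R) *
      (‖predictor L B D X U s‖ + Real.exp (D * R) * R * √D * historyNorm D U s) := by
  have hR : 0 ≤ R := (norm_nonneg _).trans hL
  have m1 : s - D ∈ Icc (s - D) s := ⟨le_rfl, by linarith⟩
  have m2 : s ∈ Icc (s - D) s := ⟨by linarith, le_rfl⟩
  have hi := intervalIntegrable_of_memLp_two hU m1 m2
  have h2 : ‖∫ θ in (s - D)..s, U θ • flow L (s - θ) B‖ ≤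
      Real.exp (D * R) * R * ∫ θ in (s - D)..s, |U θ| :=
    norm_integral_smul_le le_rfl (by linarith) le_rfl (by positivity)
      (fun θ hθ => norm_flow_apply_le hL hB (by rw [abs_of_nonneg] <;> linarith [hθ.1, hθ.2])) hi
  have h3 := integral_abs_le_sqrt_mul_historyNorm hD hi (intervalIntegrable_sq_of_memLp_two hU m1 m2)
  have hX : X s = flow L (-D) (predictor L B D X U s -
      ∫ θ in (s - D)..s, U θ • flow L (s - θ) B) := by
    rw [predictor, add_sub_cancel_right, flow_flow_apply, neg_add_cancel, flow_zero,
      one_apply_eq_self]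
  rw [hX]
  refine norm_flow_apply_le hL ?_ (by rw [abs_neg, abs_of_pos hD])
  refine (norm_sub_le _ _).trans (add_le_add_right (h2.trans ?_) _)
  calc _ ≤ Real.exp (D * R) * R * (√D * historyNorm D U s) := by gcongr
    _ = _ := by ring

/-- Cutting the exact prediction at the horizon `h` makes the two predictions share their first
stage; only the remaining time `D - h` contributes to the difference. -/
theorem averagedPredictor_sub_predictor (L Lbar : E →L[ℝ] E) (B Bbar : E) {D s h : ℝ}
    (hh : h ∈ Icc 0 D) (X : ℝ → E) {U : ℝ → ℝ} (hU : IntervalIntegrable U volume (s - D) s) :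
    averagedPredictor L B Lbar Bbar D X U h s - predictor L B D X U s =
      (flow Lbar (D - h) - flow L (D - h))
        (flow L h (X s) + ∫ θ in (s - D)..(s + h - D), U θ • flow L (s + h - D - θ) B) +
      ∫ θ in (s + h - D)..s, U θ • (flow Lbar (s - θ) Bbar - flow L (s - θ) B) := by
  have hD : s - D ≤ s := by linarith [hh.1.trans hh.2]
  have s1 : uIcc (s - D) (s + h - D) ⊆ uIcc (s - D) s := by
    rw [uIcc_of_le hD, uIcc_of_le (by linarith [hh.1])]
    exact Icc_subset_Icc_right (by linarith [hh.2])
  have s2 : uIcc (s + h - D) s ⊆ uIcc (s - D) s := by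
    rw [uIcc_of_le hD, uIcc_of_le (by linarith [hh.2])]
    exact Icc_subset_Icc_left (by linarith [hh.1])
  have i1 := hU.mono_set s1
  have i2 := hU.mono_set s2
  have e1 : predictor L B D X U s = flow L (D - h)
      (flow L h (X s) + ∫ θ in (s - D)..(s + h - D), U θ • flow L (s + h - D - θ) B) +
      ∫ θ in (s + h - D)..s, U θ • flow L (s - θ) B := by
    rw [map_add, flow_flow_apply, flow_apply_integral L B i1, sub_add_cancel,
      show D - h + (s + h - D) = s by ring, add_assoc,
      intervalIntegral.integral_add_adjacent_intervals
        (intervalIntegrable_smul_flow L B i1 s) (intervalIntegrable_smul_flow L B i2 s)]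
    rfl
  have e2 : ∫ θ in (s + h - D)..s, U θ • (flow Lbar (s - θ) Bbar - flow L (s - θ) B) =
      (∫ θ in (s + h - D)..s, U θ • flow Lbar (s - θ) Bbar) -
        ∫ θ in (s + h - D)..s, U θ • flow L (s - θ) B := by
    simp only [smul_sub]
    exact intervalIntegral.integral_sub (intervalIntegrable_smul_flow Lbar Bbar i2 s)
      (intervalIntegrable_smul_flow L B i2 s)
  rw [e1, e2, averagedPredictor, sub_apply]
  abel

/-- The averaged feedback differs from the exact predictor feedback by a term that is small with
the mismatch of the modes. -/
theorem exists_abs_feedback_sub_le {D : ℝ} (hD : 0 < D) (R : ℝ) (hR : 0 ≤ R) :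
    ∃ c > 0, ∀ (L Lbar : E →L[ℝ] E) (B Bbar K Kbar : E) (ε : ℝ), ‖L‖ ≤ R → ‖Lbar‖ ≤ R →
      ‖B‖ ≤ R → ‖Kbar‖ ≤ R → ‖L - Lbar‖ ≤ ε → ‖B - Bbar‖ ≤ ε → ‖K - Kbar‖ ≤ ε →
      ∀ (X : ℝ → E) (U : ℝ → ℝ) (s : ℝ), MemLp U 2 (volume.restrict (Icc (s - D) s)) →
      ∀ h ∈ Icc 0 D,
        |inner ℝ Kbar (averagedPredictor L B Lbar Bbar D X U h s) -
          inner ℝ K (predictor L B D X U s)| ≤ c * ε * delayNorm D X U s := by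
  set G := Real.exp (D * R) with hG
  have hG0 : 0 < G := Real.exp_pos _
  -- `c1` bounds both the exact prediction and the common first stage; `c2` bounds the difference of
  -- the predictions per unit of `ε`. Both are uniform in the horizon `h`.
  set c1 := G * (1 + R * √D) with hc1
  set c2 := D * G ^ 2 * c1 + (D * G ^ 2 * R + G) * √D with hc2
  refine ⟨c1 + R * c2 + 1, by positivity, ?_⟩
  intro L Lbar B Bbar K Kbar ε hL hLb hB hKb eL eB eK X U s hU h hh
  have hε : 0 ≤ ε := (norm_nonneg _).trans eL
  have hi : IntervalIntegrable U volume (s - D) s :=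
    intervalIntegrable_of_memLp_two hU ⟨le_rfl, by linarith⟩ ⟨by linarith, le_rfl⟩
  set N := delayNorm D X U s with hN
  have hN0 : 0 ≤ N := delayNorm_nonneg _ _ _ _
  have hn1 := integral_abs_le_sqrt_mul_delayNorm hD X hU
  have hP := norm_predictor_le hD hL hB (X := X) hU
  have hdiff : ∀ r ∈ Icc 0 D, ‖flow Lbar r - flow L r‖ ≤ D * G ^ 2 * ε := by
    intro r hr
    refine (norm_flow_sub_flow_le hLb hL hr.1).trans ?_
    have h1 : r * R ≤ D * R := mul_le_mul_of_nonneg_right hr.2 hR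
    have h2 : ‖Lbar - L‖ ≤ ε := by rwa [norm_sub_rev]
    exact mul_le_mul (mul_le_mul hr.2 (pow_le_pow_left₀ (Real.exp_nonneg _) (Real.exp_le_exp.2 h1) 2)
      (by positivity) hD.le) h2 (norm_nonneg _) (by positivity)
  have hY : ‖flow L h (X s) + ∫ θ in (s - D)..(s + h - D), U θ • flow L (s + h - D - θ) B‖ ≤
      c1 * N := by
    have h1 : ‖flow L h (X s)‖ ≤ G * N :=
      norm_flow_apply_le hL (norm_le_delayNorm D X U s) (by rw [abs_of_nonneg hh.1]; exact hh.2)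
    have h2 : ‖∫ θ in (s - D)..(s + h - D), U θ • flow L (s + h - D - θ) B‖ ≤
        G * R * ∫ θ in (s - D)..s, |U θ| :=
      norm_integral_smul_le le_rfl (by linarith [hh.1]) (by linarith [hh.2]) (by positivity)
        (fun θ hθ => norm_flow_apply_le hL hB
          (by rw [abs_of_nonneg] <;> linarith [hθ.1, hθ.2, hh.2])) hi
    calc _ ≤ _ := norm_add_le _ _
      _ ≤ G * N + G * R * (√D * N) := add_le_add h1 (h2.trans (by gcongr))
      _ = c1 * N := by rw [hc1]; ring
  have hZ : ‖∫ θ in (s + h - D)..s, U θ • (flow Lbar (s - θ) Bbar - flow L (s - θ) B)‖ ≤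
      (D * G ^ 2 * R + G) * ε * (√D * N) := by
    refine (norm_integral_smul_le (C := (D * G ^ 2 * R + G) * ε) (α := s - D) (β := s)
      (by linarith [hh.1]) (by linarith [hh.2]) le_rfl (by positivity) (fun θ hθ => ?_) hi).trans
      (by gcongr)
    have hr : s - θ ∈ Icc 0 D := ⟨by linarith [hθ.2], by linarith [hθ.1, hh.1]⟩
    -- In this splitting `Bbar` occurs only through `Bbar - B`, so no bound on `Bbar` itself is
    -- required.
    have e : flow Lbar (s - θ) Bbar - flow L (s - θ) B =
        flow Lbar (s - θ) (Bbar - B) + (flow Lbar (s - θ) - flow L (s - θ)) B := by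
      rw [map_sub, sub_apply]; abel
    rw [e]
    calc _ ≤ _ := norm_add_le _ _
      _ ≤ G * ε + D * G ^ 2 * ε * R := by
        refine add_le_add (norm_flow_apply_le hLb (by rwa [norm_sub_rev])
          (by rw [abs_of_nonneg hr.1]; exact hr.2)) ?_
        exact (ContinuousLinearMap.le_opNorm _ _).trans
          (mul_le_mul (hdiff _ hr) hB (norm_nonneg _) (by positivity))
      _ = _ := by ring
  have hQ : ‖averagedPredictor L B Lbar Bbar D X U h s - predictor L B D X U s‖ ≤ c2 * ε * N := by
    rw [averagedPredictor_sub_predictor L Lbar B Bbar hh X hi]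
    calc _ ≤ _ := norm_add_le _ _
      _ ≤ D * G ^ 2 * ε * (c1 * N) + (D * G ^ 2 * R + G) * ε * (√D * N) := by
        refine add_le_add ?_ hZ
        exact (ContinuousLinearMap.le_opNorm _ _).trans
          (mul_le_mul (hdiff _ ⟨by linarith [hh.2], by linarith [hh.1]⟩) hY (norm_nonneg _)
            (by positivity))
      _ = _ := by rw [hc2]; ring
  have e : inner ℝ Kbar (averagedPredictor L B Lbar Bbar D X U h s) -
      inner ℝ K (predictor L B D X U s) =
      inner ℝ Kbar (averagedPredictor L B Lbar Bbar D X U h s - predictor L B D X U s) -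
        inner ℝ (K - Kbar) (predictor L B D X U s) := by
    rw [inner_sub_right, inner_sub_left]; ring
  rw [e]
  calc _ ≤ |inner ℝ Kbar (averagedPredictor L B Lbar Bbar D X U h s - predictor L B D X U s)| +
        |inner ℝ (K - Kbar) (predictor L B D X U s)| := abs_sub _ _
    _ ≤ R * (c2 * ε * N) + ε * (c1 * N) := by
      refine add_le_add ((abs_real_inner_le_norm _ _).trans ?_)
        ((abs_real_inner_le_norm _ _).trans ?_)
      · exact mul_le_mul hKb hQ (norm_nonneg _) hR
      · exact mul_le_mul eK hP (norm_nonneg _) hε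
    _ ≤ (c1 + R * c2 + 1) * ε * N := by nlinarith [mul_nonneg hε hN0]

end Perturbation

/-! ### Decay within one mode -/

section SingleMode

variable {E : Type*} [NormedAddCommGroup E] [InnerProductSpace ℝ E]

theorem integral_exp_neg_mul_le {ν a s : ℝ} (hν : 0 < ν) :
    ∫ r in a..s, Real.exp (-ν * (s - r)) ≤ 1 / ν := by
  have hd : ∀ r ∈ uIcc a s, HasDerivAt (fun r => Real.exp (-ν * (s - r)) / ν)
      (Real.exp (-ν * (s - r))) r := by
    intro r _
    have h1 : HasDerivAt (fun r => -ν * (s - r)) ν r := by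
      simpa using ((hasDerivAt_id r).const_sub s).const_mul (-ν)
    have := h1.exp.div_const ν
    rwa [mul_div_assoc, div_self hν.ne', mul_one] at this
  rw [intervalIntegral.integral_eq_sub_of_hasDerivAt hd
    (Continuous.intervalIntegrable (by fun_prop) _ _)]
  simp only [sub_self, mul_zero, Real.exp_zero]
  have : 0 ≤ Real.exp (-ν * (s - a)) / ν := by positivity
  linarith

/-- Convolution of an exponentially decaying kernel with an exponentially decaying forcing. -/
theorem norm_convolution_le {Φ : ℝ → E →L[ℝ] E} {f : ℝ → E} {M ν a s u : ℝ} (hν : 0 < ν)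
    (hM : 0 ≤ M) (hu : 0 ≤ u) (has : a ≤ s)
    (hΦ : ∀ r, 0 ≤ r → ‖Φ r‖ ≤ M * Real.exp (-(2 * ν) * r))
    (hf : ∀ r ∈ Ico a s, ‖f r‖ ≤ u * Real.exp (-ν * (r - a))) :
    ‖∫ r in a..s, Φ (s - r) (f r)‖ ≤ M * u / ν * Real.exp (-ν * (s - a)) := by
  -- Half of the kernel's rate `2ν` is spent on matching the forcing; the other half is integrated
  -- and produces `1 / ν`.
  have hbound : ‖∫ r in a..s, Φ (s - r) (f r)‖ ≤
      ∫ r in a..s, M * u * Real.exp (-ν * (s - a)) * Real.exp (-ν * (s - r)) := by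
    refine intervalIntegral.norm_integral_le_of_norm_le has ?_
      (Continuous.intervalIntegrable (by fun_prop) _ _)
    -- The forcing is bounded only before `s`, since at the end of a mode interval the input already
    -- obeys the next mode's feedback.
    have hne : ∀ᵐ r ∂(volume : Measure ℝ), r ≠ s := by simp [ae_iff, measure_singleton]
    filter_upwards [hne] with r hrs hr
    have h1 := hΦ (s - r) (by linarith [hr.2])
    have h2 := hf r ⟨hr.1.le, lt_of_le_of_ne hr.2 hrs⟩
    calc _ ≤ ‖Φ (s - r)‖ * ‖f r‖ := (Φ (s - r)).le_opNorm _
      _ ≤ M * Real.exp (-(2 * ν) * (s - r)) * (u * Real.exp (-ν * (r - a))) :=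
        mul_le_mul h1 h2 (norm_nonneg _) (by positivity)
      _ = M * u * (Real.exp (-(2 * ν) * (s - r)) * Real.exp (-ν * (r - a))) := by ring
      _ = M * u * (Real.exp (-ν * (s - a)) * Real.exp (-ν * (s - r))) := by
        rw [← Real.exp_add, ← Real.exp_add]; ring_nf
      _ = _ := by ring
  refine hbound.trans ?_
  rw [intervalIntegral.integral_const_mul]
  calc _ ≤ M * u * Real.exp (-ν * (s - a)) * (1 / ν) := by
        gcongr; exact integral_exp_neg_mul_le hν
    _ = _ := by ring

/-- The history norm after time `a`, if the input decays exponentially from time `a` on. -/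
theorem historyNorm_le_exp {D ν a b u : ℝ} (hD : 0 < D) (hν : 0 < ν) (hu : 0 ≤ u) {U : ℝ → ℝ}
    (hU : MemLp U 2 (volume.restrict (Icc (a - D) b)))
    (hbd : ∀ r ∈ Ico a b, |U r| ≤ u * Real.exp (-ν * (r - a))) {s : ℝ} (hs : s ∈ Icc a b) :
    historyNorm D U s ≤
      Real.exp (ν * D) * (historyNorm D U a + √D * u) * Real.exp (-ν * (s - a)) := by
  have hsq : ∀ c ∈ Icc (a - D) b, ∀ d ∈ Icc (a - D) b,
      IntervalIntegrable (fun θ => U θ ^ 2) volume c d :=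
    fun c hc d hd => intervalIntegrable_sq_of_memLp_two hU hc hd
  have hab := hs.1.trans hs.2
  have ma : a ∈ Icc (a - D) b := ⟨by linarith, hab⟩
  have maD : a - D ∈ Icc (a - D) b := ⟨le_rfl, by linarith⟩
  have ms : s ∈ Icc (a - D) b := ⟨by linarith [hs.1], hs.2⟩
  have msD : s - D ∈ Icc (a - D) b := ⟨by linarith [hs.1], by linarith [hs.2]⟩
  have hpart : ∀ c ∈ Icc a s, s - D ≤ c → ∫ θ in c..s, U θ ^ 2 ≤
      D * (Real.exp (ν * D) * u * Real.exp (-ν * (s - a))) ^ 2 := by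
    intro c hc hcD
    have h1 : ∫ θ in c..s, U θ ^ 2 ≤
        ∫ θ in c..s, (Real.exp (ν * D) * u * Real.exp (-ν * (s - a))) ^ 2 := by
      refine intervalIntegral.integral_mono_on_of_le_Ioo hc.2
        (hsq c ⟨by linarith [hc.1], hc.2.trans hs.2⟩ s ms) intervalIntegrable_const ?_
      intro θ hθ
      have h2 := hbd θ ⟨hc.1.trans hθ.1.le, hθ.2.trans_le hs.2⟩
      rw [← sq_abs]
      refine pow_le_pow_left₀ (abs_nonneg _) (h2.trans ?_) 2
      have h3 : Real.exp (-ν * (θ - a)) ≤ Real.exp (ν * D) * Real.exp (-ν * (s - a)) := by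
        rw [← Real.exp_add]
        refine Real.exp_le_exp.2 ?_
        nlinarith [hθ.1]
      calc _ ≤ u * (Real.exp (ν * D) * Real.exp (-ν * (s - a))) := by gcongr
        _ = _ := by ring
    refine h1.trans ?_
    rw [intervalIntegral.integral_const, smul_eq_mul]
    gcongr
    linarith
  have hA : 0 ≤ ∫ θ in (a - D)..a, U θ ^ 2 :=
    intervalIntegral.integral_nonneg (by linarith) fun _ _ => sq_nonneg _
  have hmain : ∫ θ in (s - D)..s, U θ ^ 2 ≤
      (Real.exp (ν * D) * historyNorm D U a * Real.exp (-ν * (s - a))) ^ 2 +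
      D * (Real.exp (ν * D) * u * Real.exp (-ν * (s - a))) ^ 2 := by
    -- Either the window lies entirely after `a`, or it still contains old history; in the second
    -- case `s - a ≤ D`, so the factor `e^{νD}` offsets the decay demanded of that history.
    rcases le_total a (s - D) with h | h
    · exact (hpart (s - D) ⟨h, by linarith⟩ le_rfl).trans (le_add_of_nonneg_left (sq_nonneg _))
    · rw [← intervalIntegral.integral_add_adjacent_intervals (hsq _ msD _ ma) (hsq _ ma _ ms)]
      refine add_le_add ?_ (hpart a ⟨le_rfl, hs.1⟩ h)
      have h1 : ∫ θ in (s - D)..a, U θ ^ 2 ≤ ∫ θ in (a - D)..a, U θ ^ 2 :=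
        intervalIntegral.integral_mono_interval (by linarith [hs.1]) h le_rfl
          (.of_forall fun _ => sq_nonneg _) (hsq _ maD _ ma)
      have h2 : 1 ≤ Real.exp (ν * D) * Real.exp (-ν * (s - a)) := by
        rw [← Real.exp_add]
        exact Real.one_le_exp (by nlinarith)
      have h3 : (historyNorm D U a) ^ 2 = ∫ θ in (a - D)..a, U θ ^ 2 := Real.sq_sqrt hA
      rw [← h3] at h1
      refine h1.trans (pow_le_pow_left₀ (historyNorm_nonneg _ _ _) ?_ 2)
      have := historyNorm_nonneg D U a
      nlinarith
  have hn := historyNorm_nonneg D U a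
  refine (Real.sqrt_le_sqrt hmain).trans ?_
  refine Real.sqrt_le_iff.2 ⟨by positivity, ?_⟩
  have e1 : D = √D ^ 2 := (Real.sq_sqrt hD.le).symm
  have e2 : D * (Real.exp (ν * D) * u * Real.exp (-ν * (s - a))) ^ 2 =
      (√D * (Real.exp (ν * D) * u * Real.exp (-ν * (s - a)))) ^ 2 := by rw [mul_pow (√D), ← e1]
  have e3 : Real.exp (ν * D) * (historyNorm D U a + √D * u) * Real.exp (-ν * (s - a)) =
      Real.exp (ν * D) * historyNorm D U a * Real.exp (-ν * (s - a)) +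
        √D * (Real.exp (ν * D) * u * Real.exp (-ν * (s - a))) := by ring
  rw [e2, e3, add_sq]
  have hp : 0 ≤ 2 * (Real.exp (ν * D) * historyNorm D U a * Real.exp (-ν * (s - a))) *
    (√D * (Real.exp (ν * D) * u * Real.exp (-ν * (s - a)))) := by positivity
  linarith

variable [CompleteSpace E]

/-- Uniform exponential decay within a single mode under the averaged predictor feedback. -/
theorem exists_delayNorm_le_of_isModeSolution {D R M ν : ℝ} (hD : 0 < D) (hR : 0 ≤ R) (hM : 0 < M)
    (hν : 0 < ν) :
    ∃ ε₀ > 0, ∃ c > 0, ∀ (L Lbar : E →L[ℝ] E) (B Bbar K Kbar : E), ‖L‖ ≤ R → ‖Lbar‖ ≤ R →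
      ‖B‖ ≤ R → ‖K‖ ≤ R → ‖Kbar‖ ≤ R →
      ‖L - Lbar‖ ≤ ε₀ → ‖B - Bbar‖ ≤ ε₀ → ‖K - Kbar‖ ≤ ε₀ →
      (∀ s, 0 ≤ s → ‖flow (closedLoop L B K) s‖ ≤ M * Real.exp (-(2 * ν) * s)) →
      ∀ (a b : ℝ) (X : ℝ → E) (U h : ℝ → ℝ), IsModeSolution L B D a b X U →
      (∀ s ∈ Ico a b, h s ∈ Icc 0 D ∧
        U s = inner ℝ Kbar (averagedPredictor L B Lbar Bbar D X U (h s) s)) →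
      ∀ s ∈ Icc a b, delayNorm D X U s ≤ c * Real.exp (-ν * (s - a)) * delayNorm D X U a := by
  obtain ⟨c₁, hc₁, H⟩ := exists_abs_feedback_sub_le (E := E) hD R hR
  set G := Real.exp (D * R) with hG
  have hG0 : 0 < G := Real.exp_pos _
  set F := Real.exp (ν * D) with hF
  have hF0 : 0 < F := Real.exp_pos _
  set c₂ := G * (1 + R * √D) with hc₂
  have hc₂0 : 0 < c₂ := by positivity
  -- `k` is the gain from the feedback error to the prediction and `c₃` recovers the full norm from
  -- prediction and history. `C₁` and `C₂` are the resulting coefficients of `N a` and `ε * m` in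
  -- `hm2`.
  set k := M * (R * c₁) / ν with hk
  have hk0 : 0 ≤ k := by positivity
  set c₃ := 1 + G * (G * R * √D) with hc₃
  have hc₃0 : 0 < c₃ := by positivity
  set C₁ := G * (M * c₂) + c₃ * F * (1 + √D * (R * (M * c₂))) with hC₁
  have hC₁0 : 0 < C₁ := by positivity
  set C₂ := G * k + c₃ * F * (√D * (R * k + c₁)) with hC₂
  have hC₂0 : 0 < C₂ := by have := Real.sqrt_pos.2 hD; positivity
  refine ⟨1 / (2 * C₂), by positivity, 2 * C₁, by positivity, ?_⟩
  intro L Lbar B Bbar K Kbar hL hLb hB hK hKb eL eB eK hdecay a b X U h hsol hfb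
  set ε := 1 / (2 * C₂) with hε
  have hε0 : 0 < ε := by positivity
  intro s₀ hs₀
  have hab := hs₀.1.trans hs₀.2
  set N := delayNorm D X U with hN
  have hNc : ContinuousOn N (Icc a b) :=
    hsol.continuousOn.norm.add (continuousOn_historyNorm hD.le hsol.memLp)
  -- The weighted maximum is finite because `N` is continuous on a compact interval, which is what
  -- permits absorbing it below.
  obtain ⟨t, ht, hmax⟩ := isCompact_Icc.exists_isMaxOn (nonempty_Icc.2 hab)
    ((by fun_prop : ContinuousOn (fun s => Real.exp (ν * (s - a))) (Icc a b)).mul hNc)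
  set m := Real.exp (ν * (t - a)) * N t with hm
  have hm0 : 0 ≤ m := mul_nonneg (Real.exp_nonneg _) (delayNorm_nonneg _ _ _ _)
  have hNm : ∀ r ∈ Icc a b, N r ≤ m * Real.exp (-ν * (r - a)) := by
    intro r hr
    have h1 : Real.exp (ν * (r - a)) * N r ≤ m := hmax hr
    rw [neg_mul, Real.exp_neg, ← div_eq_mul_inv, le_div_iff₀ (Real.exp_pos _)]
    linarith
  have hmem : ∀ r ∈ Icc a b, MemLp U 2 (volume.restrict (Icc (r - D) r)) := fun r hr =>
    hsol.memLp.mono_measure (Measure.restrict_mono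
      (Icc_subset_Icc (by linarith [hr.1]) hr.2) le_rfl)
  set P := predictor L B D X U with hP
  have hw : ∀ r ∈ Ico a b, |U r - inner ℝ K (P r)| ≤ c₁ * ε * m * Real.exp (-ν * (r - a)) := by
    intro r hr
    have hr' := Ico_subset_Icc_self hr
    obtain ⟨hh, hUr⟩ := hfb r hr
    have := H L Lbar B Bbar K Kbar ε hL hLb hB hKb eL eB eK X U r (hmem r hr') (h r) hh
    rw [← hUr] at this
    calc _ ≤ _ := this
      _ ≤ c₁ * ε * (m * Real.exp (-ν * (r - a))) := by gcongr; exact hNm r hr'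
      _ = _ := by ring
  have hma : a ∈ Icc a b := left_mem_Icc.2 hab
  have hPa : ‖P a‖ ≤ c₂ * N a := norm_predictor_le hD hL hB (hmem a hma)
  set p := M * (c₂ * N a) + k * ε * m with hp
  have hNa : 0 ≤ N a := delayNorm_nonneg _ _ _ _
  have hp0 : 0 ≤ p := by positivity
  have hPs : ∀ s ∈ Icc a b, ‖P s‖ ≤ p * Real.exp (-ν * (s - a)) := by
    intro s hs
    have e := hsol.predictor_eq_closedLoop hD.le K hs
    have h1 : ‖flow (closedLoop L B K) (s - a) (P a)‖ ≤
        M * (c₂ * N a) * Real.exp (-ν * (s - a)) := by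
      have h2 : Real.exp (-(2 * ν) * (s - a)) ≤ Real.exp (-ν * (s - a)) :=
        Real.exp_le_exp.2 (by have := mul_nonneg hν.le (sub_nonneg.2 hs.1); linarith)
      calc _ ≤ ‖flow (closedLoop L B K) (s - a)‖ * ‖P a‖ := ContinuousLinearMap.le_opNorm _ _
        _ ≤ M * Real.exp (-(2 * ν) * (s - a)) * (c₂ * N a) :=
          mul_le_mul (hdecay _ (by linarith [hs.1])) hPa (norm_nonneg _) (by positivity)
        _ ≤ M * Real.exp (-ν * (s - a)) * (c₂ * N a) := by gcongr
        _ = _ := by ring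
    have h2 : ‖∫ r in a..s, flow (closedLoop L B K) (s - r) ((U r - inner ℝ K (P r)) • B)‖ ≤
        M * (c₁ * ε * m * R) / ν * Real.exp (-ν * (s - a)) := by
      refine norm_convolution_le hν hM.le (by positivity) hs.1 hdecay fun r hr => ?_
      rw [norm_smul, Real.norm_eq_abs]
      calc _ ≤ c₁ * ε * m * Real.exp (-ν * (r - a)) * R :=
            mul_le_mul (hw r ⟨hr.1, hr.2.trans_le hs.2⟩) hB (norm_nonneg _) (by positivity)
        _ = _ := by ring
    rw [hP, e]
    calc _ ≤ _ := norm_add_le _ _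
      _ ≤ _ := add_le_add h1 h2
      _ = _ := by rw [hp, hk]; ring
  set u := R * p + c₁ * ε * m with hu
  have hu0 : 0 ≤ u := by positivity
  have hUs : ∀ r ∈ Ico a b, |U r| ≤ u * Real.exp (-ν * (r - a)) := by
    intro r hr
    have h1 : |inner ℝ K (P r)| ≤ R * (p * Real.exp (-ν * (r - a))) :=
      (abs_real_inner_le_norm _ _).trans
        (mul_le_mul hK (hPs r (Ico_subset_Icc_self hr)) (norm_nonneg _) hR)
    calc |U r| = |(U r - inner ℝ K (P r)) + inner ℝ K (P r)| := by rw [sub_add_cancel]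
      _ ≤ _ := abs_add_le _ _
      _ ≤ _ := add_le_add (hw r hr) h1
      _ = _ := by rw [hu]; ring
  have hhist := historyNorm_le_exp hD hν hu0 hsol.memLp hUs ht
  have hX := norm_le_predictor hD hL hB (hmem t ht) (X := X)
  have hfin : N t ≤ (G * p + c₃ * (F * (N a + √D * u))) * Real.exp (-ν * (t - a)) := by
    have h1 : N t ≤ G * ‖P t‖ + c₃ * historyNorm D U t := by
      rw [hN, delayNorm, hc₃]
      calc _ ≤ G * (‖P t‖ + G * R * √D * historyNorm D U t) + historyNorm D U t :=
            add_le_add hX le_rfl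
        _ = _ := by ring
    have h2 : historyNorm D U t ≤ F * (N a + √D * u) * Real.exp (-ν * (t - a)) := by
      refine hhist.trans ?_
      gcongr
      exact historyNorm_le_delayNorm D X U a
    calc _ ≤ _ := h1
      _ ≤ G * (p * Real.exp (-ν * (t - a))) + c₃ * (F * (N a + √D * u) * Real.exp (-ν * (t - a))) := by
        gcongr
        exact hPs t ht
      _ = _ := by ring
  have hm1 : m ≤ G * p + c₃ * (F * (N a + √D * u)) := by
    have e : Real.exp (-ν * (t - a)) = (Real.exp (ν * (t - a)))⁻¹ := by
      rw [neg_mul, Real.exp_neg]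
    rw [e, ← div_eq_mul_inv, le_div_iff₀ (Real.exp_pos _)] at hfin
    rw [hm]; linarith
  have hm2 : m ≤ C₁ * N a + C₂ * ε * m := by
    refine hm1.trans_eq ?_
    rw [hu, hp, hC₁, hC₂]; ring
  -- The choice `ε = 1 / (2 C₂)` turns `m ≤ C₁ N(a) + C₂ ε m` into a bound of `m` by `N(a)`.
  have hCε : C₂ * ε = 1 / 2 := by rw [hε]; field_simp
  have hm3 : m ≤ 2 * C₁ * N a := by rw [hCε] at hm2; linarith
  calc N s₀ ≤ m * Real.exp (-ν * (s₀ - a)) := hNm s₀ hs₀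
    _ ≤ 2 * C₁ * N a * Real.exp (-ν * (s₀ - a)) := by gcongr
    _ = _ := by ring

end SingleMode

/-! ### Switching times -/

namespace IsSwitchingSignal

variable {p : ℕ} {τmin τmax : ℝ} {t : ℕ → ℝ} {σ : ℝ → Fin p}

theorem lt_succ (h : IsSwitchingSignal τmin τmax t σ) (hτ : 0 < τmin) (k : ℕ) :
    t k < t (k + 1) := by linarith [h.min_dwell k]

theorem strictMono (h : IsSwitchingSignal τmin τmax t σ) (hτ : 0 < τmin) : StrictMono t :=
  strictMono_nat_of_lt_succ (h.lt_succ hτ)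

theorem nonneg (h : IsSwitchingSignal τmin τmax t σ) (hτ : 0 < τmin) (k : ℕ) : 0 ≤ t k :=
  h.zero ▸ (h.strictMono hτ).monotone k.zero_le

theorem mul_le (h : IsSwitchingSignal τmin τmax t σ) (k : ℕ) : k * τmin ≤ t k := by
  induction k with
  | zero => simp [h.zero]
  | succ k ih => push_cast; linarith [h.min_dwell k]

theorem exists_lt (h : IsSwitchingSignal τmin τmax t σ) (hτ : 0 < τmin) (s : ℝ) :
    ∃ k, s < t k := by
  obtain ⟨k, hk⟩ := exists_nat_gt (s / τmin)
  exact ⟨k, ((div_lt_iff₀ hτ).1 hk).trans_le (h.mul_le k)⟩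

theorem exists_mem_Ico (h : IsSwitchingSignal τmin τmax t σ) (hτ : 0 < τmin) {s : ℝ}
    (hs : 0 ≤ s) : ∃ k, s ∈ Ico (t k) (t (k + 1)) := by
  classical
  have hex := h.exists_lt hτ s
  obtain ⟨n, hn⟩ : ∃ n, Nat.find hex = n + 1 := by
    refine Nat.exists_eq_succ_of_ne_zero fun h0 => ?_
    have := Nat.find_spec hex
    rw [h0, h.zero] at this
    exact this.not_ge hs
  exact ⟨n, not_lt.1 (Nat.find_min hex (by omega)), hn ▸ Nat.find_spec hex⟩

theorem lastSwitch_eq (h : IsSwitchingSignal τmin τmax t σ) (hτ : 0 < τmin) {k : ℕ} {s : ℝ}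
    (hs : s ∈ Ico (t k) (t (k + 1))) : lastSwitch t s = t k := by
  refine IsGreatest.csSup_eq ⟨⟨mem_range_self k, hs.1⟩, ?_⟩
  rintro _ ⟨⟨i, rfl⟩, hi⟩
  exact (h.strictMono hτ).monotone
    (Nat.lt_succ_iff.1 ((h.strictMono hτ).lt_iff_lt.1 (lt_of_le_of_lt hi hs.2)))

end IsSwitchingSignal

/-! ### Closed-loop solutions versus solutions in each mode -/

section Modes

variable {q p : ℕ}

/-- How far ahead of `s` (and at most `D`) the mode that became active at time `a` is known. -/
noncomputable def modeHorizon (D τd a s : ℝ) : ℝ := max 0 (min (a + τd - s) D)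

theorem modeHorizon_mem {D τd a s : ℝ} (hD : 0 ≤ D) : modeHorizon D τd a s ∈ Icc 0 D :=
  ⟨le_max_left _ _, max_le hD (min_le_right _ _)⟩

theorem continuous_modeHorizon (D τd a : ℝ) : Continuous (modeHorizon D τd a) := by
  unfold modeHorizon; fun_prop

/-- The feedback `U = Kbar P` on `[a, b)`, with the averaged prediction `P` for the mode `(A, B)`
that became active at time `a`. -/
def HasModeFeedback (D τd : ℝ) (A : Matrix (Fin q) (Fin q) ℝ) (B : State q)
    (Abar : Matrix (Fin q) (Fin q) ℝ) (Bbar Kbar : State q) (a b : ℝ) (X : ℝ → State q)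
    (U : ℝ → ℝ) : Prop :=
  ∀ s ∈ Ico a b, U s = inner ℝ Kbar
    (averagedPredictor (matOp A) B (matOp Abar) Bbar D X U (modeHorizon D τd a s) s)

theorem intervalIntegrable_vectorField {E : Type*} [NormedAddCommGroup E] [NormedSpace ℝ E]
    (L : E →L[ℝ] E) (B : E) {D a b : ℝ} {X : ℝ → E} {U : ℝ → ℝ} (hab : a ≤ b)
    (hD : 0 ≤ D) (hX : ContinuousOn X (Icc a b)) (hU : MemLp U 2 (volume.restrict (Icc (a - D) b))) :
    IntervalIntegrable (fun r => L (X r) + U (r - D) • B) volume a b := by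
  have hi : IntervalIntegrable U volume (a - D) (b - D) := intervalIntegrable_of_memLp_two hU
    ⟨le_rfl, by linarith⟩ ⟨by linarith, by linarith⟩
  have hi' := hi.comp_sub_right D
  simp only [sub_add_cancel] at hi'
  rw [← uIcc_of_le hab] at hX
  exact (L.continuous.comp_continuousOn hX).intervalIntegrable.add
    (hi'.smul_continuousOn continuousOn_const)

variable {D τd τmax : ℝ} {A : Fin p → Matrix (Fin q) (Fin q) ℝ} {B : Fin p → State q}
  {t : ℕ → ℝ} {σ : ℝ → Fin p} {X : ℝ → State q} {U : ℝ → ℝ}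

/-- The signal may differ from `σ (t k)` only at the right endpoint, a null set. -/
theorem IsSwitchingSignal.integral_vectorField_eq (h : IsSwitchingSignal τd τmax t σ) {k : ℕ} {s : ℝ}
    (hs : s ∈ Icc (t k) (t (k + 1))) :
    ∫ r in (t k)..s, (matOp (A (σ r)) (X r) + U (r - D) • B (σ r)) =
      ∫ r in (t k)..s, (matOp (A (σ (t k))) (X r) + U (r - D) • B (σ (t k))) := by
  refine intervalIntegral.integral_congr_Ioo_of_le hs.1 fun r hr => ?_
  simp only [h.const k r ⟨hr.1.le, hr.2.trans_le hs.2⟩]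

theorem IsSwitchingSignal.intervalIntegrable_vectorField_mode (h : IsSwitchingSignal τd τmax t σ)
    {k : ℕ} {s : ℝ} (hs : s ∈ Icc (t k) (t (k + 1)))
    (hi : IntervalIntegrable (fun r => matOp (A (σ (t k))) (X r) + U (r - D) • B (σ (t k)))
      volume (t k) s) :
    IntervalIntegrable (fun r => matOp (A (σ r)) (X r) + U (r - D) • B (σ r)) volume (t k) s := by
  refine hi.congr_uIoo fun r hr => ?_
  rw [uIoo_of_le hs.1] at hr
  simp only [h.const k r ⟨hr.1.le, hr.2.trans_le hs.2⟩]

theorem IsSwitchingSignal.intervalIntegrable_vectorField (h : IsSwitchingSignal τd τmax t σ)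
    (hτ : 0 < τd) (hD : 0 ≤ D) (hX : ContinuousOn X (Ici 0))
    (hU : ∀ T : ℝ, MemLp U 2 (volume.restrict (Icc (-D) T))) {k : ℕ} {s : ℝ}
    (hs : s ∈ Icc (t k) (t (k + 1))) :
    IntervalIntegrable (fun r => matOp (A (σ r)) (X r) + U (r - D) • B (σ r)) volume (t k) s := by
  have h0 := h.nonneg hτ k
  refine h.intervalIntegrable_vectorField_mode hs
    (_root_.intervalIntegrable_vectorField _ _ hs.1 hD (hX.mono fun r hr => h0.trans hr.1) ?_)
  exact (hU s).mono_measure (Measure.restrict_mono (Icc_subset_Icc_left (by linarith)) le_rfl)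

theorem IsSwitchingSignal.intervalIntegrable_vectorField_zero (h : IsSwitchingSignal τd τmax t σ)
    (hτ : 0 < τd) (hD : 0 ≤ D) (hX : ContinuousOn X (Ici 0))
    (hU : ∀ T : ℝ, MemLp U 2 (volume.restrict (Icc (-D) T))) (k : ℕ) :
    IntervalIntegrable (fun r => matOp (A (σ r)) (X r) + U (r - D) • B (σ r)) volume 0 (t k) := by
  rw [← h.zero]
  exact IntervalIntegrable.trans_iterate fun i _ =>
    h.intervalIntegrable_vectorField hτ hD hX hU (right_mem_Icc.2 (h.lt_succ hτ i).le)

variable {Abar : Matrix (Fin q) (Fin q) ℝ} {Bbar Kbar X0 : State q} {U0 : ℝ → ℝ}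

theorem averagePredictorFeedback_eq (h : IsSwitchingSignal τd τmax t σ) (hτ : 0 < τd) {k : ℕ}
    {s : ℝ} (hs : s ∈ Ico (t k) (t (k + 1))) :
    averagePredictorFeedback D τd A B Abar Bbar Kbar t σ X U s = inner ℝ Kbar
      (averagedPredictor (matOp (A (σ (t k)))) (B (σ (t k))) (matOp Abar) Bbar D X U
        (modeHorizon D τd (t k) s) s) := by
  rw [averagePredictorFeedback, horizon, h.lastSwitch_eq hτ hs]
  rfl

/-- Restarting the integral equation at `t k` requires integrability on `[0, t k]`, which is
assembled from the earlier modes. -/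
theorem IsClosedLoopSolution.isModeSolution
    (hsol : IsClosedLoopSolution D τd A B Abar Bbar Kbar t σ X0 U0 X U)
    (h : IsSwitchingSignal τd τmax t σ) (hτ : 0 < τd) (hD : 0 ≤ D) (k : ℕ) :
    IsModeSolution (matOp (A (σ (t k)))) (B (σ (t k))) D (t k) (t (k + 1)) X U := by
  have h0 := h.nonneg hτ k
  refine ⟨hsol.continuousOn.mono fun r hr => h0.trans hr.1,
    (hsol.memLp (t (k + 1))).mono_measure
      (Measure.restrict_mono (Icc_subset_Icc_left (by linarith)) le_rfl), fun s hs => ?_⟩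
  rw [← h.integral_vectorField_eq hs, hsol.plant s (h0.trans hs.1), hsol.plant (t k) h0, add_assoc,
    intervalIntegral.integral_add_adjacent_intervals
      (h.intervalIntegrable_vectorField_zero hτ hD hsol.continuousOn hsol.memLp k)
      (h.intervalIntegrable_vectorField hτ hD hsol.continuousOn hsol.memLp hs)]

theorem IsClosedLoopSolution.hasModeFeedback
    (hsol : IsClosedLoopSolution D τd A B Abar Bbar Kbar t σ X0 U0 X U)
    (h : IsSwitchingSignal τd τmax t σ) (hτ : 0 < τd) (k : ℕ) :
    HasModeFeedback D τd (A (σ (t k))) (B (σ (t k))) Abar Bbar Kbar (t k) (t (k + 1)) X U :=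
  fun s hs => by
    rw [hsol.control s ((h.nonneg hτ k).trans hs.1), averagePredictorFeedback_eq h hτ hs]

/-- A pair that is a solution on each mode interval is a solution of the closed loop. -/
theorem IsClosedLoopSolution.of_forall_isModeSolution (h : IsSwitchingSignal τd τmax t σ)
    (hτ : 0 < τd) (hD : 0 ≤ D) (hX : ContinuousOn X (Ici 0))
    (hU : ∀ T : ℝ, MemLp U 2 (volume.restrict (Icc (-D) T))) (hX0 : X 0 = X0)
    (hU0 : ∀ θ < 0, U θ = U0 θ)
    (hmode : ∀ k, IsModeSolution (matOp (A (σ (t k)))) (B (σ (t k))) D (t k) (t (k + 1)) X U)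
    (hfb : ∀ k, HasModeFeedback D τd (A (σ (t k))) (B (σ (t k))) Abar Bbar Kbar
      (t k) (t (k + 1)) X U) :
    IsClosedLoopSolution D τd A B Abar Bbar Kbar t σ X0 U0 X U := by
  refine ⟨hX, hU, ?_, ?_, ?_⟩
  · rw [← restrict_Ico_eq_restrict_Icc]
    exact (ae_restrict_iff' measurableSet_Ico).2 (.of_forall fun θ hθ => hU0 θ hθ.2)
  · have key : ∀ k, X (t k) = X0 +
        ∫ r in (0 : ℝ)..(t k), (matOp (A (σ r)) (X r) + U (r - D) • B (σ r)) := by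
      intro k
      induction k with
      | zero => simp [h.zero, hX0]
      | succ k ih =>
        have hm : t (k + 1) ∈ Icc (t k) (t (k + 1)) := right_mem_Icc.2 (h.lt_succ hτ k).le
        rw [(hmode k).plant _ hm, ih, ← h.integral_vectorField_eq hm, add_assoc,
          intervalIntegral.integral_add_adjacent_intervals
            (h.intervalIntegrable_vectorField_zero hτ hD hX hU k)
            (h.intervalIntegrable_vectorField hτ hD hX hU hm)]
    intro s hs
    obtain ⟨k, hk⟩ := h.exists_mem_Ico hτ hs
    have hm := Ico_subset_Icc_self hk
    rw [(hmode k).plant _ hm, key k, ← h.integral_vectorField_eq hm, add_assoc,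
      intervalIntegral.integral_add_adjacent_intervals
        (h.intervalIntegrable_vectorField_zero hτ hD hX hU k)
        (h.intervalIntegrable_vectorField hτ hD hX hU hm)]
  · intro s hs
    obtain ⟨k, hk⟩ := h.exists_mem_Ico hτ hs
    rw [averagePredictorFeedback_eq h hτ hk, hfb k s hk]

/-- Decay over the mode intervals, with a dwell time that outweighs the overshoot, gives
exponential decay. -/
theorem IsSwitchingSignal.le_exp_of_forall_mode (h : IsSwitchingSignal τd τmax t σ) (hτ : 0 < τd)
    {V : ℝ → ℝ} {c ν : ℝ} (hc : 0 ≤ c) (hν : 0 < ν) (hcτ : c * Real.exp (-ν * τd) ≤ 1)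
    (hV0 : ∀ s, 0 ≤ V s)
    (hV : ∀ k, ∀ s ∈ Icc (t k) (t (k + 1)), V s ≤ c * Real.exp (-(2 * ν) * (s - t k)) * V (t k))
    {s : ℝ} (hs : 0 ≤ s) : V s ≤ c * V 0 * Real.exp (-ν * s) := by
  -- Half of the rate `2ν` cancels the overshoot `c` over a full dwell period, the other half
  -- telescopes. No power of `c` accumulates; one factor remains for the last, incomplete interval.
  have key : ∀ k, V (t k) ≤ V 0 * Real.exp (-ν * t k) := by
    intro k
    induction k with
    | zero => simp [h.zero]
    | succ k ih =>
      have hd := h.min_dwell k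
      have h1 : c * Real.exp (-ν * (t (k + 1) - t k)) ≤ 1 := by
        refine (mul_le_mul_of_nonneg_left (Real.exp_le_exp.2 ?_) hc).trans hcτ
        have := mul_le_mul_of_nonneg_left hd hν.le
        linarith
      calc V (t (k + 1)) ≤ _ := hV k _ (right_mem_Icc.2 (h.lt_succ hτ k).le)
        _ = c * Real.exp (-ν * (t (k + 1) - t k)) * (Real.exp (-ν * (t (k + 1) - t k)) * V (t k)) := by
          rw [show -(2 * ν) * (t (k + 1) - t k) =
            -ν * (t (k + 1) - t k) + -ν * (t (k + 1) - t k) by ring, Real.exp_add]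
          ring
        _ ≤ 1 * (Real.exp (-ν * (t (k + 1) - t k)) * (V 0 * Real.exp (-ν * t k))) := by
          have := hV0 (t k)
          gcongr
        _ = V 0 * (Real.exp (-ν * (t (k + 1) - t k)) * Real.exp (-ν * t k)) := by ring
        _ = _ := by rw [← Real.exp_add]; ring_nf
  obtain ⟨k, hk⟩ := h.exists_mem_Ico hτ hs
  have h1 : Real.exp (-(2 * ν) * (s - t k)) ≤ Real.exp (-ν * (s - t k)) :=
    Real.exp_le_exp.2 (by nlinarith [hk.1])
  calc V s ≤ _ := hV k s (Ico_subset_Icc_self hk)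
    _ ≤ c * Real.exp (-ν * (s - t k)) * (V 0 * Real.exp (-ν * t k)) := by
      have := hV0 (t k)
      gcongr
      exact key k
    _ = c * V 0 * (Real.exp (-ν * (s - t k)) * Real.exp (-ν * t k)) := by ring
    _ = _ := by rw [← Real.exp_add]; ring_nf

end Modes

/-! ### A fixed-point theorem for Volterra operators -/

section Volterra

/-- A causal Lipschitz operator of Volterra type on `C([a, b])` has a fixed point. -/
theorem exists_fixedPoint_of_volterra {a b c : ℝ} (hab : a ≤ b) (hc : 0 < c)
    (T : C(Icc a b, ℝ) → C(Icc a b, ℝ))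
    (hT : ∀ u v (s : Icc a b), |T u s - T v s| ≤
      c * ∫ θ in a..s, |IccExtend hab u θ - IccExtend hab v θ|) :
    ∃ u, T u = u := by
  have hIcc : ∀ w : C(Icc a b, ℝ), Continuous (IccExtend hab w) := fun w => w.continuous.Icc_extend'
  -- Conjugating with the weight `e^{l(s-a)}` replaces the Lipschitz constant by `c / l = 1/2`,
  -- whatever the length of the interval.
  set l := 2 * c with hl
  have hl0 : 0 < l := by positivity
  let e : C(Icc a b, ℝ) := ⟨fun s => Real.exp (l * (s - a)), by fun_prop⟩
  let e' : C(Icc a b, ℝ) := ⟨fun s => Real.exp (-l * (s - a)), by fun_prop⟩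
  have hee : e * e' = 1 := by
    ext s
    simp [e, e', ← Real.exp_add]
  have hcontr : ContractingWith (1 / 2) fun v => e' * T (e * v) := by
    refine ⟨by norm_num, LipschitzWith.of_dist_le_mul fun v w => ?_⟩
    refine (ContinuousMap.dist_le (by positivity)).2 fun s => ?_
    have hint : ∫ θ in a..s, |IccExtend hab (e * v) θ - IccExtend hab (e * w) θ| ≤
        ∫ θ in a..s, Real.exp (l * (θ - a)) * dist v w := by
      refine intervalIntegral.integral_mono_on s.2.1
        (Continuous.intervalIntegrable ?_ _ _) (Continuous.intervalIntegrable (by fun_prop) _ _) ?_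
      · exact ((hIcc (e * v)).sub (hIcc (e * w))).abs
      · intro θ hθ
        have hθ' : θ ∈ Icc a b := ⟨hθ.1, hθ.2.trans s.2.2⟩
        rw [IccExtend_of_mem _ _ hθ', IccExtend_of_mem _ _ hθ', ContinuousMap.mul_apply,
          ContinuousMap.mul_apply, ← mul_sub, abs_mul]
        refine mul_le_mul (abs_of_pos (Real.exp_pos _)).le ?_ (abs_nonneg _) (Real.exp_nonneg _)
        exact (Real.dist_eq _ _).ge.trans (ContinuousMap.dist_apply_le_dist (f := v) (g := w) ⟨θ, hθ'⟩)
    have hexp : Real.exp (-l * (s - a)) * ∫ θ in a..s, Real.exp (l * (θ - a)) ≤ 1 / l := by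
      rw [← intervalIntegral.integral_const_mul]
      refine le_of_eq_of_le ?_ (integral_exp_neg_mul_le (a := a) (s := s) hl0)
      refine intervalIntegral.integral_congr fun θ _ => ?_
      rw [← Real.exp_add]; ring_nf
    rw [Real.dist_eq, ContinuousMap.mul_apply, ContinuousMap.mul_apply, ← mul_sub, abs_mul,
      abs_of_pos (show 0 < e' s from Real.exp_pos _)]
    have hd : 0 ≤ dist v w := dist_nonneg
    calc e' s * |T (e * v) s - T (e * w) s| ≤
          Real.exp (-l * (s - a)) * (c * ∫ θ in a..s, Real.exp (l * (θ - a)) * dist v w) := by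
          refine mul_le_mul_of_nonneg_left ((hT _ _ s).trans ?_) (Real.exp_nonneg _)
          gcongr
      _ = c * (Real.exp (-l * (s - a)) * ∫ θ in a..s, Real.exp (l * (θ - a))) * dist v w := by
          rw [intervalIntegral.integral_mul_const]; ring
      _ ≤ c * (1 / l) * dist v w := by gcongr
      _ = _ := by rw [hl]; push_cast; field_simp
  have hfix : e' * T (e * ContractingWith.fixedPoint _ hcontr) = ContractingWith.fixedPoint _ hcontr :=
    hcontr.fixedPoint_isFixedPt
  refine ⟨e * ContractingWith.fixedPoint _ hcontr, ?_⟩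
  conv_rhs => rw [← hfix]
  rw [← mul_assoc, hee, one_mul]

end Volterra

/-! ### Existence within one mode -/

section ModeExistence

variable {E : Type*} [NormedAddCommGroup E] [InnerProductSpace ℝ E] [CompleteSpace E]

/-- The solution of `X' = L X + U(· - D) B`, `X(a) = x`. -/
noncomputable def modeState (L : E →L[ℝ] E) (B : E) (D a : ℝ) (x : E) (U : ℝ → ℝ) (s : ℝ) : E :=
  flow L (s - a) x + ∫ θ in (a - D)..(s - D), U θ • flow L (s - D - θ) B

variable {L : E →L[ℝ] E} {B : E} {D a b : ℝ} {x : E} {U : ℝ → ℝ}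

theorem continuousOn_integral_smul_flow (hU : IntervalIntegrable U volume a b) (hab : a ≤ b) :
    ContinuousOn (fun s => ∫ θ in a..s, U θ • flow L (s - θ) B) (Icc a b) := by
  have hg := intervalIntegrable_smul_flow L B hU 0
  have hp := intervalIntegral.continuousOn_primitive_interval' hg left_mem_uIcc
  rw [uIcc_of_le hab] at hp
  refine ((continuous_flow L).continuousOn.clm_apply hp).congr fun s hs => ?_
  beta_reduce
  rw [flow_apply_integral L B
    (hU.mono_set (by rw [uIcc_of_le hs.1, uIcc_of_le hab]; exact Icc_subset_Icc_right hs.2))]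
  simp

theorem continuousOn_modeState (hD : 0 ≤ D) (hab : a ≤ b)
    (hU : IntervalIntegrable U volume (a - D) b) : ContinuousOn (modeState L B D a x U) (Icc a b) := by
  have hc := continuous_flow L
  refine ContinuousOn.add (by fun_prop) ?_
  exact (continuousOn_integral_smul_flow (L := L) (B := B) hU (by linarith)).comp (by fun_prop)
    fun s hs => ⟨by linarith [hs.1], by linarith [hs.2]⟩

theorem isModeSolution_modeState (hD : 0 ≤ D) (hab : a ≤ b)
    (hU : MemLp U 2 (volume.restrict (Icc (a - D) b))) :
    IsModeSolution L B D a b (modeState L B D a x U) U := by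
  have hi : IntervalIntegrable U volume (a - D) b := intervalIntegrable_of_memLp_two hU
    ⟨le_rfl, by linarith⟩ ⟨by linarith, le_rfl⟩
  refine ⟨continuousOn_modeState hD hab hi, hU, ?_⟩
  have hi' : IntervalIntegrable (fun r => U (r - D)) volume a b := by
    have h1 : IntervalIntegrable U volume (a - D) (b - D) := intervalIntegrable_of_memLp_two hU
      ⟨le_rfl, by linarith⟩ ⟨by linarith, by linarith⟩
    simpa using h1.comp_sub_right D
  have hx : modeState L B D a x U a = x := by simp [modeState, flow_zero]
  rw [hx]
  refine integral_eq_of_eq_flow_add_integral (f := fun r => U (r - D) • B)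
    (hi'.smul_continuousOn (g := fun _ => B) continuousOn_const) fun s _ => ?_
  rw [modeState, ← intervalIntegral.integral_comp_sub_right
    (fun θ => U θ • flow L (s - D - θ) B)]
  simp [sub_sub_sub_cancel_right]

variable {Lbar : E →L[ℝ] E} {Bbar : E}

/-- Eliminates the state, so that the feedback law becomes an equation for the input alone. -/
theorem averagedPredictor_modeState (hU : IntervalIntegrable U volume (a - D) b) {s h : ℝ}
    (hs : s ∈ Icc a b) (hh : h ∈ Icc 0 D) :
    averagedPredictor L B Lbar Bbar D (modeState L B D a x U) U h s =
      flow Lbar (D - h) (flow L (s + h - a) x +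
        ∫ θ in (a - D)..(s + h - D), U θ • flow L (s + h - D - θ) B) +
      ∫ θ in (s + h - D)..s, U θ • flow Lbar (s - θ) Bbar := by
  have hsub : ∀ {c d : ℝ}, a - D ≤ c → c ≤ d → d ≤ b → IntervalIntegrable U volume c d := by
    intro c d h1 h2 h3
    refine hU.mono_set ?_
    rw [uIcc_of_le h2, uIcc_of_le (h1.trans (h2.trans h3))]
    exact Icc_subset_Icc h1 h3
  have i1 := hsub (c := a - D) (d := s - D) le_rfl (by linarith [hs.1])
    (by linarith [hs.2, hh.1, hh.2])
  have i2 := hsub (c := s - D) (d := s + h - D) (by linarith [hs.1]) (by linarith [hh.1])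
    (by linarith [hs.2, hh.2])
  rw [averagedPredictor, modeState, map_add (flow L h), flow_flow_apply, flow_apply_integral L B i1,
    show h + (s - D) = s + h - D by ring, show h + (s - a) = s + h - a by ring, add_assoc (flow L _ x),
    intervalIntegral.integral_add_adjacent_intervals (intervalIntegrable_smul_flow L B i1 _)
      (intervalIntegrable_smul_flow L B i2 _)]

theorem continuousOn_averagedPredictor_modeState (hD : 0 ≤ D) (hab : a ≤ b)
    (hU : IntervalIntegrable U volume (a - D) b) {h : ℝ → ℝ} (hc : Continuous h)
    (hh : ∀ s, h s ∈ Icc 0 D) :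
    ContinuousOn (fun s => averagedPredictor L B Lbar Bbar D (modeState L B D a x U) U (h s) s)
      (Icc a b) := by
  have hmaps : ∀ s ∈ Icc a b, s + h s - D ∈ Icc (a - D) b := fun s hs =>
    ⟨by linarith [hs.1, (hh s).1], by linarith [hs.2, (hh s).2]⟩
  have hmaps' : ∀ s ∈ Icc a b, s ∈ Icc (a - D) b := fun s hs => ⟨by linarith [hs.1], hs.2⟩
  have hL := continuous_flow L
  have hLb := continuous_flow Lbar
  have c1 : ContinuousOn (fun s => ∫ θ in (a - D)..(s + h s - D), U θ • flow L (s + h s - D - θ) B)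
      (Icc a b) :=
    (continuousOn_integral_smul_flow (L := L) (B := B) hU (by linarith)).comp (by fun_prop) hmaps
  have hI : ∀ {c}, c ∈ Icc (a - D) b → IntervalIntegrable U volume (a - D) c := fun {c} hc =>
    hU.mono_set (by
      rw [uIcc_of_le hc.1, uIcc_of_le (hc.1.trans hc.2)]; exact Icc_subset_Icc_right hc.2)
  have hp := intervalIntegral.continuousOn_primitive_interval'
    (intervalIntegrable_smul_flow Lbar Bbar hU 0) left_mem_uIcc
  rw [uIcc_of_le (by linarith)] at hp
  have c2 : ContinuousOn (fun s => ∫ θ in (s + h s - D)..s, U θ • flow Lbar (s - θ) Bbar)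
      (Icc a b) := by
    have h1 : ContinuousOn (fun s => flow Lbar s ((∫ θ in (a - D)..s, U θ • flow Lbar (0 - θ) Bbar) -
        ∫ θ in (a - D)..(s + h s - D), U θ • flow Lbar (0 - θ) Bbar)) (Icc a b) :=
      hLb.continuousOn.clm_apply ((hp.mono hmaps').sub (hp.comp (by fun_prop) hmaps))
    refine h1.congr fun s hs => ?_
    beta_reduce
    have j1 := hI (hmaps' s hs)
    have j2 := hI (hmaps s hs)
    rw [intervalIntegral.integral_interval_sub_left (intervalIntegrable_smul_flow _ _ j1 0)
      (intervalIntegrable_smul_flow _ _ j2 0), flow_apply_integral Lbar Bbar (j2.symm.trans j1),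
      add_zero]
  have c3 : ContinuousOn (fun s => flow L (s + h s - a) x +
      ∫ θ in (a - D)..(s + h s - D), U θ • flow L (s + h s - D - θ) B) (Icc a b) :=
    ContinuousOn.add (by fun_prop) c1
  have c4 : ContinuousOn (fun s => flow Lbar (D - h s)) (Icc a b) := by fun_prop
  exact ((c4.clm_apply c3).add c2).congr fun s hs => averagedPredictor_modeState hU hs (hh s)

/-- The terms in `x` cancel and the inputs agree before `a`. Since `s + h - D ≤ s`, the prediction
uses inputs only up to time `s`, which gives the Volterra form. -/
theorem exists_norm_averagedPredictor_modeState_sub_le (L Lbar : E →L[ℝ] E) (B Bbar x : E) {a b : ℝ}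
    (hD : 0 ≤ D) (hab : a ≤ b) :
    ∃ c > 0, ∀ U V : ℝ → ℝ, IntervalIntegrable U volume (a - D) b →
      IntervalIntegrable V volume (a - D) b → (∀ θ < a, U θ = V θ) → ∀ s ∈ Icc a b, ∀ h ∈ Icc 0 D,
      ‖averagedPredictor L B Lbar Bbar D (modeState L B D a x U) U h s -
        averagedPredictor L B Lbar Bbar D (modeState L B D a x V) V h s‖ ≤
          c * ∫ θ in a..s, |U θ - V θ| := by
  set R := ‖L‖ + ‖Lbar‖ + ‖B‖ + ‖Bbar‖ with hR
  have hR0 : 0 ≤ R := by positivity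
  have hL : ‖L‖ ≤ R := by rw [hR]; linarith [norm_nonneg L, norm_nonneg Lbar, norm_nonneg B, norm_nonneg Bbar]
  have hLb : ‖Lbar‖ ≤ R := by rw [hR]; linarith [norm_nonneg L, norm_nonneg Lbar, norm_nonneg B, norm_nonneg Bbar]
  have hB : ‖B‖ ≤ R := by rw [hR]; linarith [norm_nonneg L, norm_nonneg Lbar, norm_nonneg B, norm_nonneg Bbar]
  have hBb : ‖Bbar‖ ≤ R := by rw [hR]; linarith [norm_nonneg L, norm_nonneg Lbar, norm_nonneg B, norm_nonneg Bbar]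
  -- All flow times are at most `b - a + D`, the extreme value of `s + h - D - θ` for `θ ≥ a - D`.
  set G := Real.exp ((b - a + D) * R) with hG
  have hG0 : 0 < G := Real.exp_pos _
  refine ⟨G * (G * R) + G * R + 1, by positivity, ?_⟩
  intro U V hU hV hUV s hs h hh
  have has : a - D ≤ s := by linarith [hs.1]
  have hsub : ∀ {W : ℝ → ℝ}, IntervalIntegrable W volume (a - D) b → ∀ {c d : ℝ}, a - D ≤ c →
      c ≤ d → d ≤ s → IntervalIntegrable W volume c d := by
    intro W hW c d h1 h2 h3
    refine hW.mono_set ?_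
    rw [uIcc_of_le h2, uIcc_of_le (h1.trans (h2.trans (h3.trans hs.2)))]
    exact Icc_subset_Icc h1 (h3.trans hs.2)
  have hUVi := hsub (hU.sub hV) le_rfl has le_rfl
  have hn : ∫ θ in (a - D)..s, |U θ - V θ| = ∫ θ in a..s, |U θ - V θ| := by
    have h0 : ∫ θ in (a - D)..a, |U θ - V θ| = 0 := by
      rw [intervalIntegral.integral_congr_Ioo_of_le (g := fun _ => (0 : ℝ)) (by linarith)
        fun θ hθ => by simp [hUV θ hθ.2]]
      simp
    rw [← intervalIntegral.integral_add_adjacent_intervals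
      (hsub (hU.sub hV) le_rfl (by linarith) hs.1).abs
      (hsub (hU.sub hV) (by linarith) hs.1 le_rfl).abs, h0, zero_add]
  have e1 : (a - D) ≤ s + h - D := by linarith [hs.1, hh.1]
  have e2 : s + h - D ≤ s := by linarith [hh.2]
  rw [averagedPredictor_modeState hU hs hh, averagedPredictor_modeState hV hs hh]
  have hdiff : ∀ (L' : E →L[ℝ] E) (B' : E) {c d : ℝ} (r : ℝ), a - D ≤ c → c ≤ d → d ≤ s →
      (∫ θ in c..d, U θ • flow L' (r - θ) B') - ∫ θ in c..d, V θ • flow L' (r - θ) B' =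
        ∫ θ in c..d, (U θ - V θ) • flow L' (r - θ) B' := by
    intro L' B' c d r h1 h2 h3
    simp only [sub_smul]
    exact (intervalIntegral.integral_sub (intervalIntegrable_smul_flow L' B' (hsub hU h1 h2 h3) r)
      (intervalIntegrable_smul_flow L' B' (hsub hV h1 h2 h3) r)).symm
  rw [add_sub_add_comm, ← map_sub, add_sub_add_left_eq_sub, hdiff L B _ le_rfl e1 e2,
    hdiff Lbar Bbar _ e1 e2 le_rfl, ← hn]
  set n := ∫ θ in (a - D)..s, |U θ - V θ| with hnn
  have hn0 : 0 ≤ n := intervalIntegral.integral_nonneg has fun _ _ => abs_nonneg _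
  have b1 : ‖∫ θ in (a - D)..(s + h - D), (U θ - V θ) • flow L (s + h - D - θ) B‖ ≤ G * R * n :=
    norm_integral_smul_le le_rfl e1 e2 (by positivity)
      (fun θ hθ => norm_flow_apply_le hL hB
        (by rw [abs_of_nonneg] <;> linarith [hθ.1, hθ.2, hs.2, hh.2])) hUVi
  have b2 : ‖∫ θ in (s + h - D)..s, (U θ - V θ) • flow Lbar (s - θ) Bbar‖ ≤ G * R * n :=
    norm_integral_smul_le e1 e2 le_rfl (by positivity)
      (fun θ hθ => norm_flow_apply_le hLb hBb
        (by rw [abs_of_nonneg] <;> linarith [hθ.1, hθ.2, hs.2, hh.1])) hUVi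
  calc _ ≤ _ := norm_add_le _ _
    _ ≤ G * (G * R * n) + G * R * n := by
      refine add_le_add (norm_flow_apply_le hLb b1 ?_) b2
      rw [abs_of_nonneg] <;> linarith [hh.1, hh.2]
    _ ≤ _ := by nlinarith

/-- Existence of a solution in a single mode, with prescribed state and input history. -/
theorem exists_isModeSolution (L Lbar : E →L[ℝ] E) (B Bbar K x : E) (hD : 0 ≤ D) (hab : a ≤ b)
    {V : ℝ → ℝ} (hV : MemLp V 2 (volume.restrict (Icc (a - D) a))) {h : ℝ → ℝ} (hc : Continuous h)
    (hh : ∀ s, h s ∈ Icc 0 D) :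
    ∃ (X : ℝ → E) (U : ℝ → ℝ), X a = x ∧ (∀ θ < a, U θ = V θ) ∧ IsModeSolution L B D a b X U ∧
      ∀ s ∈ Icc a b, U s = inner ℝ K (averagedPredictor L B Lbar Bbar D X U (h s) s) := by
  classical
  -- The unknown is the continuous input on `[a, b]`, preceded by the given `L²` history. The value
  -- at `a` belongs to the unknown, as the feedback must hold there.
  let ext : C(Icc a b, ℝ) → ℝ → ℝ := fun u => (Iio a).piecewise V (IccExtend hab u)
  have hext_lt : ∀ u, ∀ θ < a, ext u θ = V θ := fun u θ hθ => piecewise_eq_of_mem _ _ _ hθ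
  have hext_ge : ∀ u, ∀ θ, a ≤ θ → ext u θ = IccExtend hab u θ := fun u θ hθ =>
    piecewise_eq_of_notMem _ _ _ (not_lt.2 hθ)
  have hmem : ∀ u, MemLp (ext u) 2 (volume.restrict (Icc (a - D) b)) := by
    intro u
    refine MemLp.piecewise measurableSet_Iio ?_ ?_
    · rw [Measure.restrict_restrict measurableSet_Iio]
      exact hV.mono_measure (Measure.restrict_mono
        (show Iio a ∩ Icc (a - D) b ⊆ Icc (a - D) a from fun θ hθ => ⟨hθ.2.1, hθ.1.le⟩) le_rfl)
    · have h1 : MemLp (IccExtend hab u) 2 (volume.restrict (Icc (a - D) b)) :=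
        .of_bound u.continuous.Icc_extend'.aestronglyMeasurable ‖u‖
          (.of_forall fun θ => u.norm_coe_le_norm _)
      exact h1.restrict _
  have hint : ∀ u, IntervalIntegrable (ext u) volume (a - D) b := fun u =>
    intervalIntegrable_of_memLp_two (hmem u) ⟨le_rfl, by linarith⟩ ⟨by linarith, le_rfl⟩
  let T : C(Icc a b, ℝ) → C(Icc a b, ℝ) := fun u =>
    ⟨fun s => inner ℝ K (averagedPredictor L B Lbar Bbar D (modeState L B D a x (ext u)) (ext u)
      (h s) s), continuous_const.inner (continuousOn_iff_continuous_domRestrict.1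
        (continuousOn_averagedPredictor_modeState hD hab (hint u) hc hh))⟩
  obtain ⟨c, hc0, H⟩ := exists_norm_averagedPredictor_modeState_sub_le L Lbar B Bbar x hD hab
  obtain ⟨u, hu⟩ := exists_fixedPoint_of_volterra hab (c := (‖K‖ + 1) * c) (by positivity) T (by
    intro u v s
    have h1 := H (ext u) (ext v) (hint u) (hint v)
      (fun θ hθ => by rw [hext_lt u θ hθ, hext_lt v θ hθ]) s s.2 (h s) (hh s)
    have h2 : ∫ θ in a..s, |ext u θ - ext v θ| =
        ∫ θ in a..s, |IccExtend hab u θ - IccExtend hab v θ| := by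
      refine intervalIntegral.integral_congr fun θ hθ => ?_
      rw [uIcc_of_le s.2.1] at hθ
      simp only [hext_ge _ θ hθ.1]
    rw [h2] at h1
    change |inner ℝ K _ - inner ℝ K _| ≤ _
    rw [← inner_sub_right, mul_assoc]
    exact (abs_real_inner_le_norm _ _).trans
      (mul_le_mul (by linarith) h1 (norm_nonneg _) (by positivity)))
  refine ⟨modeState L B D a x (ext u), ext u, by simp [modeState, flow_zero], hext_lt u,
    isModeSolution_modeState hD hab (hmem u), fun s hs => ?_⟩
  have := DFunLike.congr_fun hu ⟨s, hs⟩
  rw [hext_ge u s hs.1, IccExtend_of_mem _ _ hs, ← this]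
  rfl

end ModeExistence

/-! ### Causality: dependence on past values only -/

section Congruence

variable {E : Type*} [NormedAddCommGroup E] [InnerProductSpace ℝ E]

theorem averagedPredictor_congr {L Lbar : E →L[ℝ] E} {B Bbar : E} {D s h : ℝ} {X X' : ℝ → E}
    {U U' : ℝ → ℝ} (hh : h ∈ Icc 0 D) (hX : X s = X' s) (hU : ∀ θ ≤ s, U θ = U' θ) :
    averagedPredictor L B Lbar Bbar D X U h s = averagedPredictor L B Lbar Bbar D X' U' h s := by
  have e : ∀ {F : ℝ → E} {c d : ℝ}, c ≤ d → d ≤ s →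
      ∫ θ in c..d, U θ • F θ = ∫ θ in c..d, U' θ • F θ := by
    intro F c d hcd hds
    refine intervalIntegral.integral_congr fun θ hθ => ?_
    rw [uIcc_of_le hcd] at hθ
    simp only [hU θ (hθ.2.trans hds)]
  rw [averagedPredictor, averagedPredictor, hX, e (by linarith [hh.1]) (by linarith [hh.2]),
    e (by linarith [hh.2]) le_rfl]

theorem memLp_two_congr_Iio {U U' : ℝ → ℝ} {α β : ℝ} (hU : ∀ θ < β, U θ = U' θ)
    (h : MemLp U 2 (volume.restrict (Icc α β))) : MemLp U' 2 (volume.restrict (Icc α β)) := by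
  refine (memLp_congr_ae ?_).1 h
  rw [← restrict_Ico_eq_restrict_Icc]
  exact (ae_restrict_iff' measurableSet_Ico).2 (.of_forall fun θ hθ => hU θ hθ.2)

theorem IsModeSolution.congr {L : E →L[ℝ] E} {B : E} {D a b : ℝ} {X X' : ℝ → E} {U U' : ℝ → ℝ}
    (h : IsModeSolution L B D a b X U) (hD : 0 < D) (hX : ∀ s ≤ b, X s = X' s)
    (hU : ∀ θ < b, U θ = U' θ) : IsModeSolution L B D a b X' U' := by
  refine ⟨h.continuousOn.congr fun s hs => (hX s hs.2).symm, memLp_two_congr_Iio hU h.memLp,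
    fun s hs => ?_⟩
  rw [← hX s hs.2, ← hX a (hs.1.trans hs.2), h.plant s hs]
  congr 1
  refine intervalIntegral.integral_congr fun r hr => ?_
  rw [uIcc_of_le hs.1] at hr
  -- Agreement of the inputs strictly before `b` is enough because `D > 0` gives `r - D < b`.
  simp only [hX r (hr.2.trans hs.2), hU (r - D) (by linarith [hr.2, hs.2])]

end Congruence

/-! ### Gluing the modes into a global solution -/

section Gluing

variable {q p : ℕ}

/-- `(X, U)` solves the closed loop on the first `n` mode intervals. -/
structure IsSolutionUpTo (D τd : ℝ) (A : Fin p → Matrix (Fin q) (Fin q) ℝ) (B : Fin p → State q)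
    (Abar : Matrix (Fin q) (Fin q) ℝ) (Bbar Kbar : State q) (t : ℕ → ℝ) (σ : ℝ → Fin p)
    (X0 : State q) (U0 : ℝ → ℝ) (n : ℕ) (X : ℝ → State q) (U : ℝ → ℝ) : Prop where
  continuousOn : ContinuousOn X (Icc 0 (t n))
  memLp : MemLp U 2 (volume.restrict (Icc (-D) (t n)))
  initial : X 0 = X0
  history : ∀ θ < 0, U θ = U0 θ
  mode : ∀ k < n, IsModeSolution (matOp (A (σ (t k)))) (B (σ (t k))) D (t k) (t (k + 1)) X U
  feedback : ∀ k < n, HasModeFeedback D τd (A (σ (t k))) (B (σ (t k))) Abar Bbar Kbar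
    (t k) (t (k + 1)) X U

variable {D τd τmax : ℝ} {A : Fin p → Matrix (Fin q) (Fin q) ℝ} {B : Fin p → State q}
  {Abar : Matrix (Fin q) (Fin q) ℝ} {Bbar Kbar : State q} {t : ℕ → ℝ} {σ : ℝ → Fin p}
  {X0 : State q} {U0 : ℝ → ℝ} {n : ℕ} {X X' : ℝ → State q} {U U' : ℝ → ℝ}

theorem HasModeFeedback.congr {A : Matrix (Fin q) (Fin q) ℝ} {B : State q} {a b : ℝ}
    (h : HasModeFeedback D τd A B Abar Bbar Kbar a b X U) (hD : 0 ≤ D)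
    (hX : ∀ s ≤ b, X s = X' s) (hU : ∀ θ < b, U θ = U' θ) :
    HasModeFeedback D τd A B Abar Bbar Kbar a b X' U' := fun s hs => by
  rw [← hU s hs.2, h s hs, averagedPredictor_congr (modeHorizon_mem hD) (hX s hs.2.le)
    fun θ hθ => hU θ (hθ.trans_lt hs.2)]

theorem IsSolutionUpTo.congr (h : IsSolutionUpTo D τd A B Abar Bbar Kbar t σ X0 U0 n X U)
    (hσ : IsSwitchingSignal τd τmax t σ) (hτ : 0 < τd) (hD : 0 < D)
    (hX : ∀ s ≤ t n, X s = X' s) (hU : ∀ θ < t n, U θ = U' θ) :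
    IsSolutionUpTo D τd A B Abar Bbar Kbar t σ X0 U0 n X' U' := by
  have h0 := hσ.nonneg hτ n
  have hle : ∀ {k}, k < n → t (k + 1) ≤ t n := fun {k} hk => (hσ.strictMono hτ).monotone hk
  exact ⟨h.continuousOn.congr fun s hs => (hX s hs.2).symm, memLp_two_congr_Iio hU h.memLp,
    by rw [← hX 0 h0, h.initial], fun θ hθ => by rw [← hU θ (hθ.trans_le h0), h.history θ hθ],
    fun k hk => (h.mode k hk).congr hD (fun s hs => hX s (hs.trans (hle hk)))
      fun θ hθ => hU θ (hθ.trans_le (hle hk)),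
    fun k hk => (h.feedback k hk).congr hD.le (fun s hs => hX s (hs.trans (hle hk)))
      fun θ hθ => hU θ (hθ.trans_le (hle hk))⟩

theorem IsSolutionUpTo.exists_succ (h : IsSolutionUpTo D τd A B Abar Bbar Kbar t σ X0 U0 n X U)
    (hσ : IsSwitchingSignal τd τmax t σ) (hτ : 0 < τd) (hD : 0 < D) :
    ∃ (X' : ℝ → State q) (U' : ℝ → ℝ),
      IsSolutionUpTo D τd A B Abar Bbar Kbar t σ X0 U0 (n + 1) X' U' ∧
      (∀ s ≤ t n, X s = X' s) ∧ ∀ θ < t n, U θ = U' θ := by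
  classical
  have h0 := hσ.nonneg hτ n
  have hlt := hσ.lt_succ hτ n
  obtain ⟨Y, U', hYa, hU', hmode, hfb⟩ := exists_isModeSolution (matOp (A (σ (t n)))) (matOp Abar)
    (B (σ (t n))) Bbar Kbar (X (t n)) hD.le hlt.le
    (h.memLp.mono_measure (Measure.restrict_mono (Icc_subset_Icc_left (by linarith)) le_rfl))
    (continuous_modeHorizon D τd (t n)) fun s => modeHorizon_mem hD.le
  -- The state is continuous across `t n` because `Y` starts from `X (t n)`. The input may jump
  -- there, which is why inputs are compared only strictly before `t n`.
  let X' : ℝ → State q := (Iic (t n)).piecewise X Y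
  have hXX' : ∀ s ≤ t n, X s = X' s := fun s hs => (piecewise_eq_of_mem (Iic (t n)) X Y hs).symm
  have hYX' : ∀ s, t n ≤ s → Y s = X' s := fun s hs => by
    rcases hs.eq_or_lt with rfl | hs
    · rw [hYa, hXX' _ le_rfl]
    · exact (piecewise_eq_of_notMem (Iic (t n)) X Y (not_le.2 hs)).symm
  have hUU' : ∀ θ < t n, U θ = U' θ := fun θ hθ => (hU' θ hθ).symm
  have hold := h.congr hσ hτ hD hXX' hUU'
  have hnew : IsModeSolution (matOp (A (σ (t n)))) (B (σ (t n))) D (t n) (t (n + 1)) X' U' := by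
    refine ⟨hmode.continuousOn.congr fun s hs => (hYX' s hs.1).symm, hmode.memLp, fun s hs => ?_⟩
    rw [← hYX' s hs.1, ← hYX' _ le_rfl, hmode.plant s hs]
    congr 1
    refine intervalIntegral.integral_congr fun r hr => ?_
    rw [uIcc_of_le hs.1] at hr
    simp only [hYX' r hr.1]
  refine ⟨X', U', ⟨?_, ?_, hold.initial, hold.history, ?_, ?_⟩, hXX', hUU'⟩
  · rw [← Icc_union_Icc_eq_Icc h0 hlt.le]
    exact hold.continuousOn.union_of_isClosed hnew.continuousOn isClosed_Icc isClosed_Icc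
  · have := MemLp.piecewise (μ := volume.restrict (Icc (-D) (t (n + 1)))) (f := U') (g := U')
      (s := Iic (t n)) (p := 2) measurableSet_Iic ?_ ?_
    · rwa [piecewise_same] at this
    · rw [Measure.restrict_restrict measurableSet_Iic]
      exact hold.memLp.mono_measure (Measure.restrict_mono
        (show Iic (t n) ∩ Icc (-D) (t (n + 1)) ⊆ Icc (-D) (t n) from
          fun θ hθ => ⟨hθ.2.1, hθ.1⟩) le_rfl)
    · rw [Measure.restrict_restrict measurableSet_Iic.compl]
      refine hmode.memLp.mono_measure (Measure.restrict_mono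
        (show (Iic (t n))ᶜ ∩ Icc (-D) (t (n + 1)) ⊆ Icc (t n - D) (t (n + 1)) from
          fun θ hθ => ⟨?_, hθ.2.2⟩) le_rfl)
      have : t n < θ := not_le.1 hθ.1
      linarith
  · intro k hk
    rcases Nat.lt_succ_iff_lt_or_eq.1 hk with hk | rfl
    · exact hold.mode k hk
    · exact hnew
  · intro k hk
    rcases Nat.lt_succ_iff_lt_or_eq.1 hk with hk | rfl
    · exact hold.feedback k hk
    · intro s hs
      rw [hfb s (Ico_subset_Icc_self hs)]
      congr 1
      exact averagedPredictor_congr (modeHorizon_mem hD.le) (hYX' s hs.1) fun θ _ => rfl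

/-- Successive extensions leave the past unchanged, so the limit at time `s` can be read off from
any stage whose interval extends beyond `s`; the minimal dwell time ensures that such a stage
exists. -/
theorem exists_isClosedLoopSolution (A : Fin p → Matrix (Fin q) (Fin q) ℝ) (B : Fin p → State q)
    (Abar : Matrix (Fin q) (Fin q) ℝ) (Bbar Kbar : State q) (X0 : State q)
    (hσ : IsSwitchingSignal τd τmax t σ) (hτ : 0 < τd)
    (hD : 0 < D) (hU0 : MemLp U0 2 (volume.restrict (Icc (-D) 0))) :
    ∃ X U, IsClosedLoopSolution D τd A B Abar Bbar Kbar t σ X0 U0 X U := by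
  let Good : ℕ → (ℝ → State q) × (ℝ → ℝ) → Prop := fun n z =>
    IsSolutionUpTo D τd A B Abar Bbar Kbar t σ X0 U0 n z.1 z.2
  have h0 : Good 0 (fun _ => X0, U0) :=
    ⟨continuousOn_const, by rwa [hσ.zero], rfl, fun _ _ => rfl, by simp, by simp⟩
  have hstep : ∀ n, ∀ z : {z // Good n z}, ∃ z' : {z // Good (n + 1) z},
      (∀ s ≤ t n, z.1.1 s = z'.1.1 s) ∧ ∀ θ < t n, z.1.2 θ = z'.1.2 θ := by
    rintro n ⟨z, hz⟩
    obtain ⟨X', U', h1, h2, h3⟩ := hz.exists_succ hσ hτ hD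
    exact ⟨⟨(X', U'), h1⟩, h2, h3⟩
  choose next hnextX hnextU using hstep
  let z : ∀ n, {z // Good n z} := fun n => Nat.rec ⟨_, h0⟩ next n
  have hzX : ∀ {m n}, m ≤ n → ∀ s ≤ t m, (z m).1.1 s = (z n).1.1 s := by
    intro m n hmn
    induction n, hmn using Nat.le_induction with
    | base => exact fun _ _ => rfl
    | succ n hmn ih =>
      exact fun s hs => (ih s hs).trans
        (hnextX n (z n) s (hs.trans ((hσ.strictMono hτ).monotone hmn)))
  have hzU : ∀ {m n}, m ≤ n → ∀ θ < t m, (z m).1.2 θ = (z n).1.2 θ := by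
    intro m n hmn
    induction n, hmn using Nat.le_induction with
    | base => exact fun _ _ => rfl
    | succ n hmn ih =>
      exact fun s hs => (ih s hs).trans
        (hnextU n (z n) s (hs.trans_le ((hσ.strictMono hτ).monotone hmn)))
  choose κ hκ using hσ.exists_lt hτ
  set X : ℝ → State q := fun s => (z (κ s)).1.1 s with hX
  set U : ℝ → ℝ := fun s => (z (κ s)).1.2 s with hU
  have hup : ∀ n, IsSolutionUpTo D τd A B Abar Bbar Kbar t σ X0 U0 n X U := by
    intro n
    refine IsSolutionUpTo.congr (z n).2 hσ hτ hD (fun s hs => ?_) fun θ hθ => ?_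
    · rcases le_total n (κ s) with h | h
      · exact hzX h s hs
      · exact (hzX h s (hκ s).le).symm
    · rcases le_total n (κ θ) with h | h
      · exact hzU h θ hθ
      · exact (hzU h θ (hκ θ)).symm
  refine ⟨X, U, IsClosedLoopSolution.of_forall_isModeSolution hσ hτ hD.le ?_ ?_ (hup 0).initial
    (hup 0).history (fun k => (hup (k + 1)).mode k k.lt_succ_self)
    fun k => (hup (k + 1)).feedback k k.lt_succ_self⟩
  · intro s hs
    -- As `s < t (κ s)` strictly, `[0, t (κ s)]` is a neighbourhood of `s` in `[0, ∞)`.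
    refine ((hup (κ s)).continuousOn s ⟨hs, (hκ s).le⟩).mono_of_mem_nhdsWithin ?_
    rw [← Ici_inter_Iic]
    exact Filter.inter_mem self_mem_nhdsWithin (mem_nhdsWithin_of_mem_nhds (Iic_mem_nhds (hκ s)))
  · intro T
    exact (hup (κ T)).memLp.mono_measure
      (Measure.restrict_mono (Icc_subset_Icc_right (hκ T).le) le_rfl)

end Gluing

/-! ### Assembly of the main theorem -/

theorem matOp_closedLoopMatrix {q : ℕ} (A : Matrix (Fin q) (Fin q) ℝ) (B K : State q) :
    matOp (closedLoopMatrix A B K) = closedLoop (matOp A) B K := by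
  ext1 x
  have h : matOp (Matrix.vecMulVec B.ofLp K.ofLp) x = inner ℝ K x • B := by
    ext i
    rw [matOp, ← WithLp.toLp_ofLp 2 x, Matrix.toEuclideanCLM_toLp]
    simp [Matrix.vecMulVec_mulVec, PiLp.inner_apply, dotProduct, mul_comm]
  rw [closedLoop_apply, ← h, closedLoopMatrix, matOp, map_add]
  rfl

theorem continuous_closedLoopMatrix {q : ℕ} : Continuous
    fun c : Matrix (Fin q) (Fin q) ℝ × State q × State q => closedLoopMatrix c.1 c.2.1 c.2.2 := by
  unfold closedLoopMatrix
  fun_prop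

theorem theorem1 (q : ℕ) (D : ℝ) (hD : 0 < D)
    (C : Set (Matrix (Fin q) (Fin q) ℝ × State q × State q)) (hC : IsCompact C)
    (hHurwitz : ∀ c ∈ C, IsHurwitz (closedLoopMatrix c.1 c.2.1 c.2.2)) :
    (∀ c ∈ C, ∃ S Q : Matrix (Fin q) (Fin q) ℝ,
      IsLyapunovPair (closedLoopMatrix c.1 c.2.1 c.2.2) S Q) ∧
    ∃ τstar : ℝ, 0 < τstar ∧ ∃ εstar : ℝ, 0 < εstar ∧
      ∀ (p : ℕ) (A : Fin p → Matrix (Fin q) (Fin q) ℝ) (B K : Fin p → State q),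
        (∀ i, (A i, B i, K i) ∈ C) →
      ∀ (Abar : Matrix (Fin q) (Fin q) ℝ) (Bbar Kbar : State q),
        mismatch A B K Abar Bbar Kbar < εstar →
      ∀ τd τdmax : ℝ, τstar < τd →
      ∃ ρ : ℝ, 0 < ρ ∧ ∃ ξ : ℝ, 0 < ξ ∧
        ∀ (t : ℕ → ℝ) (σ : ℝ → Fin p), IsSwitchingSignal τd τdmax t σ →
        ∀ (X0 : State q) (U0 : ℝ → ℝ), MemLp U0 2 (volume.restrict (Icc (-D) 0)) →
          (∃ (X : ℝ → State q) (U : ℝ → ℝ),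
            IsClosedLoopSolution D τd A B Abar Bbar Kbar t σ X0 U0 X U) ∧
          ∀ (X : ℝ → State q) (U : ℝ → ℝ),
            IsClosedLoopSolution D τd A B Abar Bbar Kbar t σ X0 U0 X U →
            ∀ s : ℝ, 0 ≤ s →
              ‖X s‖ + √(∫ θ in (s - D)..s, U θ ^ 2) ≤
                ρ * (‖X0‖ + √(∫ θ in (-D)..0, U0 θ ^ 2)) * Real.exp (-ξ * s) := by
  refine ⟨fun c hc => (hHurwitz c hc).exists_isLyapunovPair, ?_⟩
  obtain ⟨M, hM, μ, hμ, hdecay⟩ := (hC.image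
    (continuous_matOp.comp continuous_closedLoopMatrix)).exists_uniform_exponential_decay (by
      rintro _ ⟨c, hc, rfl⟩
      exact (hHurwitz c hc).tendsto_exp_pow)
  obtain ⟨R₀, hR₀⟩ := hC.exists_bound_of_continuousOn
    (f := fun c => (matOp c.1, c.2.1, c.2.2))
    ((continuous_matOp.comp continuous_fst).prodMk continuous_snd).continuousOn
  -- The extra `1` also covers `Abar`, `Bbar` and `Kbar`, which lie within distance `1` of the data
  -- of a mode.
  set R := max R₀ 0 + 1 with hR
  have hR0 : 0 ≤ R := by positivity
  have hRR : R₀ + 1 ≤ R := by rw [hR]; gcongr; exact le_max_left _ _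
  obtain ⟨ε₀, hε₀, c, hc, H⟩ := exists_delayNorm_le_of_isModeSolution (E := State q) hD hR0 hM
    (half_pos hμ)
  -- The closed-loop rate `μ` is halved to `2ν` by the single-mode estimate and halved again to `ν`
  -- by the chaining over switches.
  set ν := μ / 4 with hν
  have hν0 : 0 < ν := by positivity
  -- Beyond `log c / ν` one has `c e^{-ν τd} ≤ 1`; the `1` in the maximum keeps the threshold
  -- positive. The `1` in the minimum keeps the averaged data in the ball of radius `R`.
  refine ⟨max 1 (Real.log c / ν), lt_max_of_lt_left one_pos, min 1 ε₀, lt_min one_pos hε₀, ?_⟩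
  intro p A B K hmem Abar Bbar Kbar hmis τd τdmax hτ
  have hτ0 : 0 < τd := one_pos.trans ((le_max_left _ _).trans_lt hτ)
  have hcτ : c * Real.exp (-ν * τd) ≤ 1 := by
    have h1 : Real.log c ≤ ν * τd := by
      have := (le_max_right 1 (Real.log c / ν)).trans hτ.le
      rwa [div_le_iff₀ hν0, mul_comm] at this
    rw [← Real.exp_log hc, ← Real.exp_add]
    exact Real.exp_le_one_iff.2 (by linarith)
  refine ⟨c, hc, ν, hν0, ?_⟩
  intro t σ hσ X0 U0 hU0
  refine ⟨exists_isClosedLoopSolution A B Abar Bbar Kbar X0 hσ hτ0 hD hU0, ?_⟩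
  intro X U hsol s hs
  have hbd : ∀ i, max ‖matOp (A i - Abar)‖ (max ‖B i - Bbar‖ ‖K i - Kbar‖) < min 1 ε₀ := fun i =>
    (le_ciSup (f := fun i => max ‖matOp (A i - Abar)‖ (max ‖B i - Bbar‖ ‖K i - Kbar‖))
      (Set.finite_range _).bddAbove i).trans_lt hmis
  have hV : ∀ k, ∀ s ∈ Icc (t k) (t (k + 1)), delayNorm D X U s ≤
      c * Real.exp (-(2 * ν) * (s - t k)) * delayNorm D X U (t k) := by
    intro k
    set i := σ (t k) with hi
    have hb := hR₀ _ (hmem i)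
    simp only [Prod.norm_def, max_le_iff] at hb
    obtain ⟨b1, b2⟩ := max_lt_iff.1 (hbd i)
    obtain ⟨b2, b3⟩ := max_lt_iff.1 b2
    have hsub : matOp (A i - Abar) = matOp (A i) - matOp Abar :=
      map_sub (Matrix.toEuclideanCLM (n := Fin q) (𝕜 := ℝ)) _ _
    rw [hsub] at b1
    have near : ∀ {F : Type} [NormedAddCommGroup F] {x y : F}, ‖x‖ ≤ R₀ → ‖x - y‖ < min 1 ε₀ →
        ‖y‖ ≤ R := by
      intro F _ x y hx hxy
      have h1 : ‖y‖ ≤ ‖x‖ + ‖x - y‖ := by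
        have := norm_sub_le x (x - y)
        rwa [sub_sub_cancel] at this
      linarith [hxy.trans_le (min_le_left 1 ε₀)]
    have h2 : 2 * ν = μ / 2 := by rw [hν]; ring
    rw [h2]
    refine H (matOp (A i)) (matOp Abar) (B i) Bbar (K i) Kbar (by linarith) (near hb.1 b1)
      (by linarith) (by linarith) (near hb.2.2 b3) (b1.le.trans (min_le_right _ _))
      (b2.le.trans (min_le_right _ _)) (b3.le.trans (min_le_right _ _)) ?_ (t k) (t (k + 1)) X U
      (modeHorizon D τd (t k)) (hsol.isModeSolution hσ hτ0 hD.le k) fun s hs =>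
        ⟨modeHorizon_mem hD.le, hsol.hasModeFeedback hσ hτ0 k s hs⟩
    intro s hs
    rw [mul_div_cancel₀ μ two_ne_zero, ← matOp_closedLoopMatrix]
    exact hdecay _ ⟨_, hmem i, rfl⟩ s hs
  have hfin := hσ.le_exp_of_forall_mode hτ0 hc.le hν0 hcτ (delayNorm_nonneg D X U) hV hs
  have hX0 : X 0 = X0 := by simpa using hsol.plant 0 le_rfl
  -- `U` and `U0` agree only almost everywhere on `[-D, 0]`, which suffices for the integral.
  have hU0' : ∫ θ in (0 - D)..0, U θ ^ 2 = ∫ θ in (-D)..0, U0 θ ^ 2 := by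
    rw [zero_sub, intervalIntegral.integral_of_le (by linarith),
      intervalIntegral.integral_of_le (by linarith), ← integral_Icc_eq_integral_Ioc,
      ← integral_Icc_eq_integral_Ioc]
    exact integral_congr_ae (hsol.initial.mono fun θ hθ => by simp only [hθ])
  have h0 : delayNorm D X U 0 = ‖X0‖ + √(∫ θ in (-D)..0, U0 θ ^ 2) := by
    rw [delayNorm, historyNorm, hX0, hU0']
  rwa [h0] at hfin
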